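/- **Definitions.** For $n\ge 0$ let $\mathcal I_n$ be the set of involutions $\pi$ of $\{1,\dots,n\}$ (permutations with $\pi^2=1$). An occurrence of a pattern $\tau\in S_m$ in $\pi$ is a sequence of positions $i_1<\dots<i_m$ such that $\pi(i_1)\cdots\pi(i_m)$ is order-isomorphic to $\tau$; $21(\pi)$ denotes the number of occurrences of $21$ (inversions), and $\pi$ is even or odd according to the parity of $21(\pi)$. Let $E_r(x)$ and $O_r(x)$ be the generating functions, in the number of letters $n\ge0$, of the even and the odd involutions containing $3412$ exactly $r$ times, and let $$N_r(x)=E_r(x)-O_r(x)=\sum_{n\ge 0}\ \sum_{\substack{\pi\in\mathcal I_n\\ \pi\text{ contains }3412\text{ exactly }r\text{ times}}}(-1)^{21(\pi)}x^n\in\mathbb Q[[x]].$$ *Kernel.* For $\pi\in\mathcal I_n$, $n\ge1$, let $G_\pi$ be the bipartite graph whose vertices are the entries of $\pi$ and the occurrences of $3412$ in $\pi$, an entry being joined to the occurrences it belongs to. The kernel of $\pi$ consists of the entries in the connected component of $G_\pi$ containing the entry $1$, together with the entry $\pi(1)$. (If the entry $1$ belongs to an occurrence of $3412$, then $\pi(1)$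 is already in that component; otherwise the kernel consists of the entries $1$ and $\pi(1)$ only.) The kernel shape of $\pi$ is the permutation $\rho$ order-isomorphic to the kernel; it is an involution. Let $K_t$ be the set of all kernel shapes of involutions in $\mathcal I_t$. For a kernel shape $\rho$ let $s(\rho)$ be its number of letters and $c(\rho)$ its number of occurrences of $3412$. *Cells.* Let $\rho$ be a kernel shape, $s=s(\rho)$, let $\pi\in\mathcal I_n$, and let positions $i_1<\dots<i_s$ be such that $\pi(i_1)\cdots\pi(i_s)$ is order-isomorphic to $\rho$. For $1\le m,\ell\le s$ the cell $C_{m\ell}$ is the set of entries $\pi(j)$ with $i_\ell<j<i_{\ell+1}$ and $\pi(i_{\rho^{-1}(m)})<\pi(j)<\pi(i_{\rho^{-1}(m+1)})$, where the upper bound on $j$ (on $\pi(j)$) is omitted if $\ell=s$ (if $m=s$). The index pair $(m,\ell)$ is called infeasible for $\rho$ if, for every involution $\pi$ and all positions $i_1<\dots<i_s$ with $\pi(i_k)=i_{\rho(k)}$ for all $k$ (a copy of $\rho$ in $\pi$), each entry in the cell $C_{m\ell}$ belongs to an occurrence of $3412$ in $\pi$ that contains at least two of the entries $\pi(i_1),\dots,\pi(i_s)$;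 otherwise it is feasible. A feasible cell is forced decreasing if, in every involution $\pi$ with kernel shape $\rho$, the entries of the cell $C_{m\ell}$ cut out by the kernel of $\pi$ are decreasing from left to right. Let $f(\rho)$ be the number of feasible cells that are not forced decreasing (free-cells), $dd(\rho)$ the number of feasible, forced decreasing cells $C_{ii}$ (diagonal-decreasing-cells), and $d(\rho)$ the number of feasible, forced decreasing cells $C_{m\ell}$ above the diagonal, that is, with $m>\ell$ (decreasing-cells). **Theorem 4.2.** For every $r\ge 0$, $$N_r(x)-\delta_{r,0}=\sum_{\rho\in K_{2r+2}}\left[\frac{(-1)^{21(\rho)}\,x^{s(\rho)}(1+x)^{dd(\rho)}}{(1+x^2)^{d(\rho)+dd(\rho)}}\sum_{r_1+\dots+r_{f(\rho)}=r-c(\rho)}\ \prod_{j=1}^{f(\rho)}N_{r_j}(x)\right]$$ as formal power series, where the inner sum is over nonnegative integers $r_1,\dots,r_{f(\rho)}$ (it is $0$ if $c(\rho)>r$), $\delta_{0,0}=1$, and $\delta_{r,0}=0$ for $r\ge1$. -/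

import Mathlib

namespace Inv3412

open Finset Function PowerSeries

/-! Permutations of `n` letters are elements of `Equiv.Perm (Fin n)`, with positions and values
numbered from `0`.  The entry at position `j` is the point `(j, π j)`; entries are referred to by
their positions. -/

/-- The pattern `3412`. -/
def p3412 : Equiv.Perm (Fin 4) where
  toFun := ![2, 3, 0, 1]
  invFun := ![2, 3, 0, 1]
  left_inv := by decide
  right_inv := by decide

/-- The pattern `21`. -/
def p21 : Equiv.Perm (Fin 2) := Equiv.swap 0 1

/-- The occurrences of the pattern `τ` in `π`: sequences of positions `i 0 < i 1 < ⋯` such that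
`π (i 0), π (i 1), …` is order-isomorphic to `τ`. -/
def occurrences {m n : ℕ} (τ : Equiv.Perm (Fin m)) (π : Equiv.Perm (Fin n)) :
    Finset (Fin m → Fin n) :=
  {i | (∀ a b, a < b → i a < i b) ∧ ∀ a b, π (i a) < π (i b) ↔ τ a < τ b}

/-- The number of occurrences of `τ` in `π`. -/
def occCount {m n : ℕ} (τ : Equiv.Perm (Fin m)) (π : Equiv.Perm (Fin n)) : ℕ :=
  (occurrences τ π).card

/-! ### The kernel of an involution -/

/-- The bipartite graph `G_π`: its vertices are the entries of `π` and the occurrences of `3412`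
in `π`; an entry is joined to an occurrence when it takes part in it. -/
def occGraph {n : ℕ} (π : Equiv.Perm (Fin n)) :
    SimpleGraph (Fin n ⊕ {o : Fin 4 → Fin n // o ∈ occurrences p3412 π}) :=
  SimpleGraph.fromRel fun u v => ∃ j o, u = Sum.inl j ∧ v = Sum.inr o ∧ j ∈ Set.range o.1

/-- The (positions of the) kernel of `π`: the entries in the connected component of `G_π` that
contains the least entry, together with the entry in the first position.  When the least entry
takes part in an occurrence of `3412`, the first position already belongs to its component; when
it does not, its component is a single vertex and the kernel is the entry `1` (if `π` fixes the
first letter) or the pair formed by the first and the least entry. -/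
def kernel {n : ℕ} (π : Equiv.Perm (Fin n)) : Set (Fin n) :=
  {j | (j : ℕ) = 0 ∨
    ∃ a : Fin n, (π a : ℕ) = 0 ∧ (occGraph π).Reachable (Sum.inl a) (Sum.inl j)}

/-- `e` lists the positions `i_1 < ⋯ < i_s` of the kernel of `π`, and the kernel is
order-isomorphic to `ρ`. -/
def IsKernelEmb {s n : ℕ} (π : Equiv.Perm (Fin n)) (ρ : Equiv.Perm (Fin s))
    (e : Fin s → Fin n) : Prop :=
  StrictMono e ∧ Set.range e = kernel π ∧ ∀ a b, π (e a) < π (e b) ↔ ρ a < ρ b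

/-- `ρ` is the kernel shape of `π`. -/
def HasKernelShape {s n : ℕ} (π : Equiv.Perm (Fin n)) (ρ : Equiv.Perm (Fin s)) : Prop :=
  ∃ e, IsKernelEmb π ρ e

open Classical in
/-- `K_t`: the kernel shapes of the involutions of `t` letters. A shape comes with its size. -/
noncomputable def kernelShapes (t : ℕ) : Finset (Σ s : ℕ, Equiv.Perm (Fin s)) :=
  (range (t + 1)).sigma fun _ =>
    {ρ | ∃ π : Equiv.Perm (Fin t), Involutive π ∧ HasKernelShape π ρ}

theorem mem_kernelShapes {t : ℕ} (ρ : Σ s : ℕ, Equiv.Perm (Fin s)) :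
    ρ ∈ kernelShapes t ↔ ∃ π : Equiv.Perm (Fin t), Involutive π ∧ HasKernelShape π ρ.2 := by
  simp only [kernelShapes, mem_sigma, mem_range, mem_filter, mem_univ, true_and,
    and_iff_right_iff_imp]
  rintro ⟨π, -, e, he, -⟩
  have := Fintype.card_le_of_injective e he.injective
  simp only [Fintype.card_fin] at this
  omega

/-! ### The kernel cell decomposition -/

/-- The (positions of the) entries of `π` in the cell `C_{mℓ}` cut out by the entries of `π` at
the positions `e 0 < e 1 < ⋯`, whose pattern is `ρ`: horizontally between the `ℓ`-th and the next
of these entries, vertically between the `m`-th smallest and the next larger one; there is no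
upper bound when the next entry does not exist. -/
def cell {s n : ℕ} (ρ : Equiv.Perm (Fin s)) (π : Equiv.Perm (Fin n)) (e : Fin s → Fin n)
    (m l : Fin s) : Set (Fin n) :=
  {j | e l < j ∧ (∀ h : (l : ℕ) + 1 < s, j < e ⟨l + 1, h⟩) ∧
    π (e (ρ.symm m)) < π j ∧ ∀ h : (m : ℕ) + 1 < s, π j < π (e (ρ.symm ⟨m + 1, h⟩))}

/-- The cell `C_{mℓ}` is infeasible for `ρ`: whenever an involution `π` contains a copy `e` of
`ρ` as a sub-involution, the existence of an entry `a` in the cell `C_{mℓ}` cut out by that copy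
forces an occurrence of `3412` in `π` that contains `a` and two entries of the copy. -/
def Infeasible {s : ℕ} (ρ : Equiv.Perm (Fin s)) (m l : Fin s) : Prop :=
  ∀ (n : ℕ) (π : Equiv.Perm (Fin n)) (e : Fin s → Fin n),
    Involutive π → StrictMono e → (∀ k, π (e k) = e (ρ k)) →
    ∀ a ∈ cell ρ π e m l, ∃ o ∈ occurrences p3412 π, ∃ x y : Fin s,
      x ≠ y ∧ a ∈ Set.range o ∧ e x ∈ Set.range o ∧ e y ∈ Set.range o

/-- In every involution with kernel shape `ρ` the entries in the cell `C_{mℓ}` are decreasing. -/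
def ForcedDecreasing {s : ℕ} (ρ : Equiv.Perm (Fin s)) (m l : Fin s) : Prop :=
  ∀ (n : ℕ) (π : Equiv.Perm (Fin n)) (e : Fin s → Fin n), Involutive π → IsKernelEmb π ρ e →
    ∀ j ∈ cell ρ π e m l, ∀ k ∈ cell ρ π e m l, j < k → π k < π j

open Classical in
/-- `f(ρ)`: the number of free-cells, the feasible cells whose content need not be decreasing. -/
noncomputable def numFree {s : ℕ} (ρ : Equiv.Perm (Fin s)) : ℕ :=
  #{c : Fin s × Fin s | ¬ Infeasible ρ c.1 c.2 ∧ ¬ ForcedDecreasing ρ c.1 c.2}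

open Classical in
/-- `dd(ρ)`: the number of diagonal-decreasing-cells, the feasible cells `C_{ii}` whose content
is always decreasing. -/
noncomputable def numDiagDec {s : ℕ} (ρ : Equiv.Perm (Fin s)) : ℕ :=
  #{i : Fin s | ¬ Infeasible ρ i i ∧ ForcedDecreasing ρ i i}

open Classical in
/-- `d(ρ)`: the number of decreasing-cells above the diagonal, the feasible cells `C_{mℓ}` with
`m > ℓ` whose content is always decreasing. -/
noncomputable def numDec {s : ℕ} (ρ : Equiv.Perm (Fin s)) : ℕ :=
  #{c : Fin s × Fin s | c.2 < c.1 ∧ ¬ Infeasible ρ c.1 c.2 ∧ ForcedDecreasing ρ c.1 c.2}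

/-! ### Generating functions -/

open Classical in
/-- The involutions of `n` letters that contain `3412` exactly `r` times. -/
noncomputable def involutions (r n : ℕ) : Finset (Equiv.Perm (Fin n)) :=
  {π | Involutive π ∧ occCount p3412 π = r}

/-- `E_r(x)`: the generating function of the even involutions containing `3412` exactly `r`
times. -/
noncomputable def evenGF (r : ℕ) : PowerSeries ℚ :=
  PowerSeries.mk fun n => (#{π ∈ involutions r n | Even (occCount p21 π)} : ℚ)

/-- `O_r(x)`: the generating function of the odd involutions containing `3412` exactly `r`
times. -/
noncomputable def oddGF (r : ℕ) : PowerSeries ℚ :=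
  PowerSeries.mk fun n => (#{π ∈ involutions r n | Odd (occCount p21 π)} : ℚ)

/-- `N_r(x) = E_r(x) - O_r(x)`. -/
noncomputable def signedGF (r : ℕ) : PowerSeries ℚ := evenGF r - oddGF r

/-- The coefficients of `N_r(x)` as signed counts. -/
theorem coeff_signedGF (r n : ℕ) :
    coeff n (signedGF r) = ∑ π ∈ involutions r n, (-1 : ℚ) ^ occCount p21 π := by
  have h1 : ∑ π ∈ involutions r n with Even (occCount p21 π), (-1 : ℚ) ^ occCount p21 π =
      ∑ π ∈ involutions r n with Even (occCount p21 π), 1 :=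
    sum_congr rfl fun π h => (mem_filter.1 h).2.neg_one_pow
  have h2 : ∑ π ∈ involutions r n with ¬ Even (occCount p21 π), (-1 : ℚ) ^ occCount p21 π =
      ∑ π ∈ involutions r n with ¬ Even (occCount p21 π), -1 :=
    sum_congr rfl fun π h => (Nat.not_even_iff_odd.1 (mem_filter.1 h).2).neg_one_pow
  rw [← sum_filter_add_sum_filter_not (involutions r n) (fun π => Even (occCount p21 π)), h1, h2]
  simp [signedGF, evenGF, oddGF, sub_eq_add_neg]

end Inv3412

namespace Inv3412

open Finset Function PowerSeries

/-! The kernel of an involution `π` is the least set of letters that contains the first one, is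
stable under `π` and contains every occurrence of `3412` that it meets (`kernel_subset`,
`kernel_closed`). So no occurrence mixes kernel entries with others, and the nonempty kernel shapes
are the nonempty involutions that are their own kernel (`Linked`).

Fix such a shape `ρ`. An entry outside the kernel can only lie in a cell where kernel entries
complete no occurrence with it; `Feas` expresses this through `ρ` alone. Linkedness forces a
feasible cell off the diagonal to lie under two crossing two-cycles (`Feas.exists_crossing`), and an
ascent in such a place would complete a `3412`. Two feasible cells in one column are impossible,
because of the letter of `ρ` separating their rows (`Feas.unique`). Hence the feasible cells are
matched by the involution `partner`; unboxed cells on the diagonal are arbitrary and all others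
decrease. Conversely every such filling has kernel shape `ρ`, since an occurrence lies in the copy
of `ρ` or in a single free cell (`Fits.occ`). Involutions with kernel shape `ρ` thus correspond to
fillings (`exists_built`, `Fits.built`).

Occurrences add up over the kernel and the free cells. The sign is `-1` to the number of two-cycles,
which is additive too. A free cell contributes some `signedGF t`, a mirrored pair of decreasing
cells `1 / (1 + X ^ 2)`, and a decreasing cell on the diagonal `(1 + X) / (1 + X ^ 2)`. Finally
`Linked.card_le`, a count of edges in a connected graph, shows that the involutions of `2 * r + 2`
letters supply all the shapes needed. The empty involution accounts for the term subtracted at `r =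
0`. -/

/-- The entries at the positions `a < b < c < d` form the pattern `3412` in `π`. -/
def Occ {n : ℕ} (π : Equiv.Perm (Fin n)) (a b c d : Fin n) : Prop :=
  a < b ∧ b < c ∧ c < d ∧ π c < π d ∧ π d < π a ∧ π a < π b

theorem mem_occurrences {n : ℕ} {π : Equiv.Perm (Fin n)} {i : Fin 4 → Fin n} :
    i ∈ occurrences p3412 π ↔ Occ π (i 0) (i 1) (i 2) (i 3) := by
  simp only [occurrences, mem_filter, mem_univ, true_and, Occ]
  constructor
  · rintro ⟨h1, h2⟩
    exact ⟨h1 0 1 (by decide), h1 1 2 (by decide), h1 2 3 (by decide), (h2 2 3).2 (by decide),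
      (h2 3 0).2 (by decide), (h2 0 1).2 (by decide)⟩
  · rintro ⟨h1, h2, h3, h4, h5, h6⟩
    constructor
    · intro a b hab
      fin_cases a <;> fin_cases b <;> simp at hab ⊢ <;> order
    · intro a b
      fin_cases a <;> fin_cases b <;> simp [p3412] <;> order

theorem mem_occurrences_cons {n : ℕ} {π : Equiv.Perm (Fin n)} {a b c d : Fin n} :
    ![a, b, c, d] ∈ occurrences p3412 π ↔ Occ π a b c d := mem_occurrences

theorem range_fin_four {α : Type*} (o : Fin 4 → α) (x : α) :
    x ∈ Set.range o ↔ x = o 0 ∨ x = o 1 ∨ x = o 2 ∨ x = o 3 := by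
  constructor
  · rintro ⟨i, rfl⟩
    fin_cases i <;> simp
  · rintro (rfl | rfl | rfl | rfl) <;> exact ⟨_, rfl⟩

/-! ### Occurrences of `3412` in involutions; the kernel as a least closed set -/

section Involution

variable {n : ℕ} {π : Equiv.Perm (Fin n)}

/-- Reflection in the diagonal preserves occurrences because `3412` is its own inverse. -/
theorem Occ.inv {a b c d : Fin n} (h : Occ π a b c d) (hπ : Involutive π) :
    Occ π (π c) (π d) (π a) (π b) := by
  obtain ⟨h1, h2, h3, h4, h5, h6⟩ := h
  refine ⟨h4, h5, h6, ?_, ?_, ?_⟩ <;> simpa only [hπ _]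

/-- The two-cycles `(u, π u)` and `(v, π v)` cross, `u` being the least of the four letters. -/
def Crossing (π : Equiv.Perm (Fin n)) (u v : Fin n) : Prop :=
  u < v ∧ v < π u ∧ π u < π v

theorem Crossing.occ {u v : Fin n} (h : Crossing π u v) (hπ : Involutive π) :
    Occ π u v (π u) (π v) := by
  obtain ⟨h1, h2, h3⟩ := h
  refine ⟨h1, h2, h3, ?_, ?_, h3⟩ <;> simpa only [hπ _]

theorem Occ.crossing_low {a b c d : Fin n} (h : Occ π a b c d) (hπ : Involutive π) (hdc : π d < c) :
    Crossing π (π c) (π d) := by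
  obtain ⟨h1, h2, h3, h4, h5, h6⟩ := h
  refine ⟨h4, ?_, ?_⟩ <;> simpa only [hπ _]

/-- If `c < π d` then `b < c < π d < π a`, while `π d = c` would give `π c = d > π d`. So the last
two or the first two letters come from crossing two-cycles, and reflection exchanges these
alternatives. -/
theorem Occ.low_or {a b c d : Fin n} (h : Occ π a b c d) (hπ : Involutive π) :
    π d < c ∨ b < π a := by
  obtain ⟨h1, h2, h3, h4, h5, h6⟩ := h
  rcases lt_trichotomy (π d) c with h | h | h
  · exact .inl h
  · have := hπ d
    rw [h] at this h4
    order
  · right; order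

/-- `S` contains every occurrence of `3412` that it meets. -/
def OccClosed (π : Equiv.Perm (Fin n)) (S : Set (Fin n)) : Prop :=
  ∀ a b c d, Occ π a b c d → (a ∈ S ∨ b ∈ S ∨ c ∈ S ∨ d ∈ S) → a ∈ S ∧ b ∈ S ∧ c ∈ S ∧ d ∈ S

/-- To prove that a set of letters contains every occurrence that it meets it suffices to
consider occurrences whose lower part consists of two crossing two-cycles. -/
theorem occClosed_of_low (hπ : Involutive π) {S : Set (Fin n)} (hS : ∀ x ∈ S, π x ∈ S)
    (h : ∀ a b c d, Occ π a b c d → π d < c → (a ∈ S ∨ b ∈ S ∨ c ∈ S ∨ d ∈ S) →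
      a ∈ S ∧ b ∈ S ∧ c ∈ S ∧ d ∈ S) : OccClosed π S := by
  have hS' : ∀ x, π x ∈ S ↔ x ∈ S := fun x => ⟨fun hx => by simpa only [hπ x] using hS _ hx, hS x⟩
  intro a b c d ho hm
  rcases ho.low_or hπ with h' | h'
  · exact h _ _ _ _ ho h' hm
  · have := h _ _ _ _ (ho.inv hπ) (by simpa only [hπ _]) (by simp only [hS']; tauto)
    simp only [hS'] at this
    tauto

theorem reachable_induction (π : Equiv.Perm (Fin n)) {a : Fin n} {S : Set (Fin n)} (ha : a ∈ S)
    (hS : OccClosed π S) {j : Fin n} (hj : (occGraph π).Reachable (Sum.inl a) (Sum.inl j)) :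
    j ∈ S := by
  -- Paths alternate between entries and occurrences, so the invariant must speak of both.
  let P : Fin n ⊕ {o : Fin 4 → Fin n // o ∈ occurrences p3412 π} → Prop :=
    fun x => x.elim (fun j => j ∈ S) fun o => ∀ i, o.1 i ∈ S
  have key : ∀ x y, (occGraph π).Reachable x y → P x → P y := by
    rintro x y ⟨w⟩
    induction w with
    | nil => exact id
    | cons h _ ih =>
      refine fun hx => ih ?_
      obtain ⟨-, ⟨j, o, rfl, rfl, i, hi⟩ | ⟨j, o, rfl, rfl, i, hi⟩⟩ := h
      · have ho := mem_occurrences.1 o.2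
        have := hS _ _ _ _ ho (by
          have hx' : o.1 i ∈ S := by rw [hi]; exact hx
          clear hi hx
          fin_cases i <;> simp_all)
        intro i
        fin_cases i
        exacts [this.1, this.2.1, this.2.2.1, this.2.2.2]
      · show j ∈ S
        rw [← hi]
        exact hx i
  exact key _ _ hj ha

theorem reachable_occ (π : Equiv.Perm (Fin n)) {a : Fin n} {o : Fin 4 → Fin n}
    (ho : o ∈ occurrences p3412 π) {x y : Fin n} (hx : x ∈ Set.range o) (hy : y ∈ Set.range o)
    (h : (occGraph π).Reachable (Sum.inl a) (Sum.inl x)) :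
    (occGraph π).Reachable (Sum.inl a) (Sum.inl y) := by
  have h1 : (occGraph π).Adj (Sum.inl x) (Sum.inr ⟨o, ho⟩) :=
    ⟨by simp, .inl ⟨x, ⟨o, ho⟩, rfl, rfl, hx⟩⟩
  have h2 : (occGraph π).Adj (Sum.inr ⟨o, ho⟩) (Sum.inl y) :=
    ⟨by simp, .inr ⟨y, ⟨o, ho⟩, rfl, rfl, hy⟩⟩
  exact h.trans (h1.reachable.trans h2.reachable)

theorem occClosed_component (π : Equiv.Perm (Fin n)) (a : Fin n) :
    OccClosed π {j | (occGraph π).Reachable (Sum.inl a) (Sum.inl j)} := by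
  intro p q r t ho hm
  have ho' := mem_occurrences_cons.2 ho
  have hr := fun x => (range_fin_four ![p, q, r, t] x).2
  have key : ∀ x y, x ∈ Set.range ![p, q, r, t] → y ∈ Set.range ![p, q, r, t] →
      (occGraph π).Reachable (Sum.inl a) (Sum.inl x) →
      (occGraph π).Reachable (Sum.inl a) (Sum.inl y) := fun x y hx hy h =>
    reachable_occ π ho' hx hy h
  have hp := hr p (by simp)
  have hq := hr q (by simp)
  have h3 := hr r (by simp)
  have h4 := hr t (by simp)
  simp only [Set.mem_ofPred_eq] at hm ⊢
  rcases hm with h | h | h | h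
  exacts [⟨h, key _ _ hp hq h, key _ _ hp h3 h, key _ _ hp h4 h⟩,
    ⟨key _ _ hq hp h, h, key _ _ hq h3 h, key _ _ hq h4 h⟩,
    ⟨key _ _ h3 hp h, key _ _ h3 hq h, h, key _ _ h3 h4 h⟩,
    ⟨key _ _ h4 hp h, key _ _ h4 hq h, key _ _ h4 h3 h, h⟩]

/-- The kernel is the least set of letters that contains the first one, is mapped to itself and
contains every occurrence of `3412` it meets. -/
theorem kernel_subset (hπ : Involutive π) {S : Set (Fin n)} (h0 : ∀ j : Fin n, (j : ℕ) = 0 → j ∈ S)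
    (hS : ∀ x ∈ S, π x ∈ S) (hocc : OccClosed π S) : kernel π ⊆ S := by
  rintro j (hj | ⟨a, ha, hr⟩)
  · exact h0 j hj
  · refine reachable_induction π ?_ hocc hr
    have := hS _ (h0 _ ha)
    rwa [hπ a] at this

theorem zero_mem_kernel (π : Equiv.Perm (Fin n)) {j : Fin n} (hj : (j : ℕ) = 0) : j ∈ kernel π :=
  .inl hj

theorem kernel_closed (hπ : Involutive π) :
    (∀ x ∈ kernel π, π x ∈ kernel π) ∧ OccClosed π (kernel π) := by
  rcases n.eq_zero_or_pos with rfl | hn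
  · exact ⟨fun x => x.elim0, fun x => x.elim0⟩
  let z : Fin n := ⟨0, hn⟩
  have hz : ∀ x : Fin n, z ≤ x := fun x => Nat.zero_le _
  have hz0 : ∀ x : Fin n, (x : ℕ) = 0 ↔ x = z := fun x => by simp [z, Fin.ext_iff]
  set C : Set (Fin n) := {j | (occGraph π).Reachable (Sum.inl (π z)) (Sum.inl j)} with hC
  have hker : kernel π = {j | j = z ∨ j ∈ C} := by
    ext j
    simp only [kernel, Set.mem_ofPred_eq, hz0, hC]
    refine or_congr Iff.rfl ⟨?_, fun h => ⟨π z, hπ z, h⟩⟩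
    rintro ⟨a, ha, h⟩
    rwa [show π z = a by rw [← ha, hπ a]]
  have hCo : OccClosed π C := occClosed_component π _
  have haC : π z ∈ C := SimpleGraph.Reachable.refl _
  by_cases hex : ∃ a b c d, Occ π a b c d ∧ (a = π z ∨ b = π z ∨ c = π z ∨ d = π z)
  · obtain ⟨a, b, c, d, ho, hm⟩ := hex
    have hzz : π (π z) = z := hπ z
    have hzC : z ∈ C := by
      have hcz : c = π z := by
        obtain ⟨h1, h2, h3, h4, h5, h6⟩ := ho
        rcases hm with rfl | rfl | rfl | rfl
        · rw [hzz] at h5; exact absurd h5 (not_lt.2 (hz _))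
        · rw [hzz] at h6; exact absurd h6 (not_lt.2 (hz _))
        · rfl
        · rw [hzz] at h4; exact absurd h4 (not_lt.2 (hz _))
      subst hcz
      -- A two-cycle crossing `(z, π z)` yields an occurrence through both `z` and `π z`, which puts
      -- `z` into the component.
      have hcr : ∃ p, Crossing π z p := by
        rcases lt_or_ge (π d) (π z) with h | h
        · obtain ⟨h1, h2, h3, h4, h5, h6⟩ := ho
          rw [hzz] at h4
          exact ⟨π d, h4, h, by rwa [hπ d]⟩
        · obtain ⟨h1, h2, h3, h4, h5, h6⟩ := ho
          have hb : z < b := lt_of_le_of_lt (hz a) h1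
          exact ⟨b, hb, h2, by order⟩
      obtain ⟨p, hp⟩ := hcr
      exact (hCo _ _ _ _ (hp.occ hπ) (.inr (.inr (.inl haC)))).1
    have hsub : ∀ x ∈ C, π x ∈ C := by
      -- The crossing inside an occurrence gives a symmetric occurrence, sharing two letters with
      -- the given one and two with its mirror image; so all three lie in one component.
      have hS : OccClosed π {x | x ∈ C ∧ π x ∈ C} := by
        intro p q r t ho hm
        have h1 := hCo _ _ _ _ ho (by simp only [Set.mem_ofPred_eq] at hm; tauto)
        have h2 : π p ∈ C ∧ π q ∈ C ∧ π r ∈ C ∧ π t ∈ C := by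
          rcases ho.low_or hπ with h | h
          · have h3 := hCo _ _ _ _ ((ho.crossing_low hπ h).occ hπ) (by simp only [hπ _]; tauto)
            have h4 := hCo _ _ _ _ (ho.inv hπ) (by tauto)
            tauto
          · have h3 := hCo _ _ _ _ (((ho.inv hπ).crossing_low hπ (by simpa only [hπ _])).occ hπ)
              (by simp only [hπ _]; tauto)
            have h4 := hCo _ _ _ _ (ho.inv hπ) (by simp only [hπ _] at h3; tauto)
            tauto
        simp only [Set.mem_ofPred_eq]
        tauto
      exact fun x hx => (reachable_induction π (S := {x | x ∈ C ∧ π x ∈ C})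
        ⟨haC, by rwa [hzz]⟩ hS hx).2
    have hkC : kernel π = C := by
      rw [hker]
      ext j
      simp only [Set.mem_ofPred_eq, or_iff_right_iff_imp]
      rintro rfl
      exact hzC
    rw [hkC]
    exact ⟨hsub, hCo⟩
  · push Not at hex
    have hsub : ∀ x ∈ C, x = π z := fun x hx =>
      reachable_induction π (S := {π z}) rfl (by
        intro a b c d ho hm
        have := hex a b c d ho
        simp only [Set.mem_singleton_iff] at hm
        tauto) hx
    have hker' : kernel π = {z, π z} := by
      rw [hker]
      ext j
      simp only [Set.mem_ofPred_eq, Set.mem_insert_iff, Set.mem_singleton_iff]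
      refine or_congr Iff.rfl ⟨hsub j, ?_⟩
      rintro rfl
      exact haC
    rw [hker']
    constructor
    · rintro x (rfl | rfl)
      · exact .inr rfl
      · exact .inl (hπ z)
    · intro a b c d ho hm
      exfalso
      have h1 := hex _ _ _ _ ho
      have h2 := hex _ _ _ _ (ho.inv hπ)
      have : ∀ x, π x = π z ↔ x = z := fun x => π.injective.eq_iff
      simp only [Ne, this] at h2
      simp only [Set.mem_insert_iff, Set.mem_singleton_iff] at hm
      tauto

end Involution

/-! ### Feasible cells of a linked involution -/

section Shape

variable {s : ℕ} {ρ : Equiv.Perm (Fin s)}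

/-- The only set of letters that contains the first one, is mapped to itself and contains every
occurrence of `3412` it meets is the set of all letters. -/
def Linked (ρ : Equiv.Perm (Fin s)) : Prop :=
  ∀ S : Set (Fin s), (∀ k : Fin s, (k : ℕ) = 0 → k ∈ S) → (∀ x ∈ S, ρ x ∈ S) → OccClosed ρ S →
    ∀ x, x ∈ S

/-- The cell in the column after the letter `l` and the row above the letter `m` meets no
occurrence of `3412` whose other entries belong to `ρ`. -/
structure Feas (ρ : Equiv.Perm (Fin s)) (l m : Fin s) : Prop where
  -- No two-cycle of `ρ` crosses the one formed by an entry of the cell and its mirror image.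
  closed : ∀ k, l < k → k ≤ m → l < ρ k ∧ ρ k ≤ m
  closed' : ∀ k, m < k → k ≤ l → m < ρ k ∧ ρ k ≤ l
  -- Here `ρ u` and `ρ v` would be the last two letters of a `3412` whose first two are the cell
  -- entry and `p`, in either order.
  avoid : ∀ p u v, Crossing ρ u v → p < ρ u → v < ρ p → l < ρ u → v ≤ m →
    ¬ (p ≤ l ∧ ρ p ≤ m) ∧ ¬ (l < p ∧ m < ρ p)
  avoid' : ∀ p u v, Crossing ρ u v → p < ρ u → v < ρ p → m < ρ u → v ≤ l →
    ¬ (p ≤ m ∧ ρ p ≤ l) ∧ ¬ (m < p ∧ l < ρ p)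

theorem Feas.symm {l m : Fin s} (h : Feas ρ l m) : Feas ρ m l :=
  ⟨h.closed', h.closed, h.avoid', h.avoid⟩

/-- The gap after the letter `l` lies under two crossing two-cycles. -/
def Boxed (ρ : Equiv.Perm (Fin s)) (l : Fin s) : Prop :=
  ∃ u v, Crossing ρ u v ∧ v ≤ l ∧ l < ρ u

/-- A cell off the diagonal lies under two crossing two-cycles. -/
theorem Feas.exists_crossing (hρ : Involutive ρ) (hL : Linked ρ) {l m : Fin s} (h : Feas ρ l m)
    (hlm : l < m) : ∃ u v, Crossing ρ u v ∧ v ≤ l ∧ m < ρ u := by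
  by_contra! hno
  have hcl : ∀ x, (l < ρ x ∧ ρ x ≤ m) ↔ (l < x ∧ x ≤ m) := by
    refine fun x => ⟨fun hx => ?_, fun hx => h.closed x hx.1 hx.2⟩
    have := h.closed _ hx.1 hx.2
    rwa [hρ x] at this
  -- Without such a crossing the letters outside `(l, m]` form a closed set that contains the first
  -- letter but not `m`.
  have := hL {x | ¬ (l < x ∧ x ≤ m)} (fun k hk => by
      simp only [Set.mem_ofPred_eq, Fin.lt_def, hk]; omega)
    (fun x hx => by simpa only [Set.mem_ofPred_eq, hcl] using hx)
    (occClosed_of_low hρ (fun x hx => by simpa only [Set.mem_ofPred_eq, hcl] using hx) ?_) m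
  · exact this ⟨hlm, le_rfl⟩
  intro a b c d ho hdc hm
  have hcr := ho.crossing_low hρ hdc
  have hbox := hno _ _ hcr
  obtain ⟨h1, h2, h3, h4, h5, h6⟩ := ho
  rw [hρ c] at hbox
  have ha := hcl a
  have hb := hcl b
  have hc := hcl c
  have hd := hcl d
  have hab : b < ρ a → b ≤ l → ρ a ≤ m := fun h => hno a b ⟨h1, h, h6⟩
  simp only [Set.mem_ofPred_eq] at hm ⊢
  simp only [Fin.lt_def, Fin.le_def] at *
  clear hno hcl hcr
  omega

/-- Two feasible cells, one of them above and to the right of the other, do not both lie over the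
lower part of two crossing two-cycles. -/
theorem Feas.not_increasing (hρ : Involutive ρ) (hL : Linked ρ) {l m l' m' : Fin s}
    (h : Feas ρ l m) (h' : Feas ρ l' m') (hl : l < l') (hm : m < m') {u v : Fin s}
    (huv : Crossing ρ u v) (hu : l' < ρ u) (hv : v ≤ m) : False := by
  -- If `l < v`, feasibility traps the whole crossing inside `(l, m]`, and a crossing around that
  -- interval replaces it.
  wlog hvl : v ≤ l generalizing u v
  · obtain ⟨h1, h2, h3⟩ := huv
    have e1 := h.closed v (lt_of_not_ge hvl) hv
    have e2 := h.closed (ρ u) (by order) (by order)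
    have e3 := h'.closed (ρ u) hu (by order)
    rw [hρ u] at e2 e3
    obtain ⟨u', v', hc, hv', hu'⟩ := h.exists_crossing hρ hL (by order)
    exact this hc (by order) (by order) hv'
  obtain ⟨h1, h2, h3⟩ := huv
  have hum : m' < ρ u := by
    by_contra hum
    have := h'.closed (ρ u) hu (le_of_not_gt hum)
    rw [hρ u] at this
    order
  -- The letter `l'` of `ρ` separates the two columns. Wherever its value can lie, it or its mirror
  -- image conflicts with one of the two cells.
  have ha := h.avoid l' u v ⟨h1, h2, h3⟩ hu
  have hb := h'.avoid l' u v ⟨h1, h2, h3⟩ hu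
  rcases lt_or_ge m (ρ l') with hq | hq
  · exact (ha (by order) (by order) hv).2 ⟨hl, hq⟩
  rcases lt_trichotomy v (ρ l') with hq' | hq' | hq'
  · exact (hb hq' hu (by order)).1 ⟨le_rfl, by order⟩
  · rw [hq', hρ l'] at h3
    order
  · have hml : m < l' := by
      by_contra hml
      have := h.closed l' hl (le_of_not_gt hml)
      order
    have hlm' : l' ≤ m' := by
      by_contra hlm
      have := h'.closed' l' (lt_of_not_ge hlm) le_rfl
      order
    exact (h'.avoid (ρ l') u v ⟨h1, h2, h3⟩ (by order) (by rw [hρ l']; order) hu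
      (by order)).1 ⟨by order, by rwa [hρ l']⟩

/-- A column contains at most one feasible cell. -/
theorem Feas.unique (hρ : Involutive ρ) (hL : Linked ρ) {l m m' : Fin s}
    (h : Feas ρ l m) (h' : Feas ρ l m') : m = m' := by
  wlog hm : m < m' generalizing m m'
  · rcases lt_trichotomy m m' with hlt | heq | hlt
    exacts [this h h' hlt, heq, (this h' h hlt).symm]
  exfalso
  obtain ⟨u, v, ⟨h1, h2, h3⟩, hvm, hvl, hum, hul⟩ :
      ∃ u v, Crossing ρ u v ∧ v ≤ m ∧ v ≤ l ∧ m' < ρ u ∧ l < ρ u := by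
    rcases lt_or_ge l m' with hlm | hlm
    · obtain ⟨u, v, hc, hv, hu⟩ := h'.exists_crossing hρ hL hlm
      refine ⟨u, v, hc, ?_, hv, hu, by order⟩
      by_contra hvm
      obtain ⟨h1, h2, h3⟩ := hc
      have := h.closed' v (lt_of_not_ge hvm) hv
      order
    · obtain ⟨u, v, hc, hv, hu⟩ := h.symm.exists_crossing hρ hL (by order)
      exact ⟨u, v, hc, hv, by order, by order, hu⟩
  -- The letter `m'` separates the two rows and plays the analogous role after reflection.
  have ha := h.avoid' m' u v ⟨h1, h2, h3⟩ hum
  have hb := h'.avoid' m' u v ⟨h1, h2, h3⟩ hum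
  rcases lt_or_ge l (ρ m') with hq | hq
  · exact (ha (by order) (by order) hvl).2 ⟨hm, hq⟩
  rcases lt_trichotomy v (ρ m') with hq' | hq' | hq'
  · exact (hb hq' hum hvl).1 ⟨le_rfl, hq⟩
  · rw [hq', hρ m'] at h3
    order
  · have hlm : l < m' := by
      by_contra hlm
      have := h.closed' m' hm (le_of_not_gt hlm)
      order
    have := h'.closed m' hlm le_rfl
    order

theorem Feas.boxed (hρ : Involutive ρ) (hL : Linked ρ) {l m : Fin s} (h : Feas ρ l m)
    (hlm : l ≠ m) : Boxed ρ l := by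
  rcases lt_or_gt_of_ne hlm with hlm | hlm
  · obtain ⟨u, v, hc, hv, hu⟩ := h.exists_crossing hρ hL hlm
    exact ⟨u, v, hc, hv, by order⟩
  · obtain ⟨u, v, hc, hv, hu⟩ := h.symm.exists_crossing hρ hL hlm
    exact ⟨u, v, hc, by order, hu⟩

/-- The cell after the last letter is feasible. -/
theorem feas_last {l : Fin s} (hl : (l : ℕ) + 1 = s) : Feas ρ l l := by
  have : ∀ x : Fin s, ¬ l < x := fun x h => by
    have := x.2
    rw [Fin.lt_def] at h
    omega
  exact ⟨fun k hk => absurd hk (this k), fun k hk => absurd hk (this k),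
    fun _ _ _ _ _ _ hk => absurd hk (this _), fun _ _ _ _ _ _ hk => absurd hk (this _)⟩

end Shape

/-! ### Occurrences in an involution filled along a shape -/

section Fits

variable {s n : ℕ} {ρ : Equiv.Perm (Fin s)} {π : Equiv.Perm (Fin n)} {e : Fin s → Fin n}

/-- The position `j` lies weakly after the `l`-th position listed by `e`, and before the next. -/
def InGap (e : Fin s → Fin n) (l : Fin s) (j : Fin n) : Prop := ∀ k, e k ≤ j ↔ k ≤ l

theorem InGap.lt_iff {l k : Fin s} {j : Fin n} (h : InGap e l j) : j < e k ↔ l < k := by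
  rw [← not_le, h k, not_le]

theorem InGap.iff_le {l k : Fin s} {j : Fin n} (h : InGap e l j) (hj : j ∉ Set.range e) :
    e k < j ↔ k ≤ l := by
  rw [← h k, lt_iff_le_and_ne, and_iff_left]
  rintro rfl
  exact hj ⟨k, rfl⟩

theorem InGap.mono {l l' : Fin s} {j j' : Fin n} (h : InGap e l j) (h' : InGap e l' j')
    (hj : j ≤ j') : l ≤ l' :=
  (h' l).1 (((h l).2 le_rfl).trans hj)

theorem InGap.unique {l l' : Fin s} {j : Fin n} (h : InGap e l j) (h' : InGap e l' j) : l = l' :=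
  le_antisymm (h.mono h' le_rfl) (h'.mono h le_rfl)

/-- The involution `π` arises from the copy `e` of `ρ` by filling the feasible cells, those that
lie under two crossing two-cycles of `ρ` being filled in decreasing order. -/
structure Fits (ρ : Equiv.Perm (Fin s)) (π : Equiv.Perm (Fin n)) (e : Fin s → Fin n) : Prop where
  mono : StrictMono e
  map : ∀ k, π (e k) = e (ρ k)
  feas : ∀ j, j ∉ Set.range e → ∃ l m, InGap e l j ∧ InGap e m (π j) ∧ Feas ρ l m
  dec : ∀ l, Boxed ρ l → ∀ j k, j ∉ Set.range e → k ∉ Set.range e → InGap e l j → InGap e l k →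
    j < k → π k < π j

theorem map_mem_range_iff (hπ : Involutive π) (hmap : ∀ k, π (e k) = e (ρ k)) {j : Fin n} :
    π j ∈ Set.range e ↔ j ∈ Set.range e := by
  constructor
  · rintro ⟨k, hk⟩
    exact ⟨ρ k, by rw [← hmap, hk, hπ j]⟩
  · rintro ⟨k, rfl⟩
    exact ⟨ρ k, (hmap k).symm⟩

/-- Split by which of `c`, `d` belong to the copy. If both do, `avoid` rules out exactly one of `a`,
`b` in a cell, and decreasing contents with `Feas.not_increasing` rule out both. If one does, its
two-cycle violates `closed'`. If neither does, they ascend within one cell; it is then unboxed and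
on the diagonal, which forces `a` and `b` into it. -/
theorem Fits.occ_of_low (h : Fits ρ π e) (hρ : Involutive ρ) (hL : Linked ρ) (hπ : Involutive π)
    {a b c d : Fin n} (ho : Occ π a b c d) (hdc : π d < c) :
    (∀ x ∈ [a, b, c, d], x ∈ Set.range e) ∨
      ∃ l, Feas ρ l l ∧ ¬ Boxed ρ l ∧ ∀ x ∈ [a, b, c, d], x ∉ Set.range e ∧ InGap e l x := by
  obtain ⟨h1, h2, h3, h4, h5, h6⟩ := ho
  have hmem := @map_mem_range_iff s n ρ π e hπ h.map
  have elt : ∀ {x y}, e x < e y ↔ x < y := h.mono.lt_iff_lt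
  by_cases hc : c ∈ Set.range e <;> by_cases hd : d ∈ Set.range e
  · obtain ⟨c, rfl⟩ := hc
    obtain ⟨d, rfl⟩ := hd
    rw [h.map, h.map] at h4
    rw [h.map] at h5 hdc
    rw [elt] at h4 h3 hdc
    have hcr : Crossing ρ (ρ c) (ρ d) := ⟨h4, by rwa [hρ c], by rwa [hρ c, hρ d]⟩
    have hb2 : b < e (ρ (ρ c)) := by rwa [hρ c]
    by_cases ha : a ∈ Set.range e <;> by_cases hb : b ∈ Set.range e
    · left
      simpa using ⟨ha, hb⟩
    · exfalso
      obtain ⟨p, rfl⟩ := ha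
      obtain ⟨l, m, hl, hm, hf⟩ := h.feas _ hb
      rw [h.map] at h5 h6
      exact (hf.avoid p _ _ hcr (elt.1 (h1.trans hb2)) (elt.1 h5) (hl.lt_iff.1 hb2)
        ((hm _).1 (h5.trans h6).le)).1 ⟨(hl _).1 h1.le, (hm _).1 h6.le⟩
    · exfalso
      obtain ⟨p, rfl⟩ := hb
      obtain ⟨l, m, hl, hm, hf⟩ := h.feas _ ha
      rw [h.map] at h6
      exact (hf.avoid p _ _ hcr (elt.1 hb2) (elt.1 (h5.trans h6)) (hl.lt_iff.1 (h1.trans hb2))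
        ((hm _).1 h5.le)).2 ⟨hl.lt_iff.1 h1, hm.lt_iff.1 h6⟩
    · exfalso
      obtain ⟨l, m, hl, hm, hf⟩ := h.feas _ ha
      obtain ⟨l', m', hl', hm', hf'⟩ := h.feas _ hb
      have key : l = l' → m = m' → False := by
        rintro rfl rfl
        have hbox : Boxed ρ l := by
          by_cases hlm : l = m
          · subst hlm
            exact ⟨_, _, hcr, (hm _).1 h5.le, hl'.lt_iff.1 hb2⟩
          · exact hf.boxed hρ hL hlm
        exact absurd (h.dec l hbox a b ha hb hl hl' h1) h6.not_gt
      rcases (hl.mono hl' h1.le).eq_or_lt with rfl | hll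
      · exact key rfl (hf.unique hρ hL hf')
      rcases (hm.mono hm' h6.le).eq_or_lt with rfl | hmm
      · exact key (hf.symm.unique hρ hL hf'.symm) rfl
      · exact hf.not_increasing hρ hL hf' hll hmm hcr (hl'.lt_iff.1 hb2) ((hm _).1 h5.le)
  · exfalso
    obtain ⟨k, rfl⟩ := hc
    obtain ⟨l, m, hl, hm, hf⟩ := h.feas _ hd
    rw [h.map] at h4
    have := hf.closed' k (hm.lt_iff.1 hdc) ((hl _).1 h3.le)
    have := (hm _).1 h4.le
    order
  · exfalso
    obtain ⟨k, rfl⟩ := hd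
    obtain ⟨l, m, hl, hm, hf⟩ := h.feas _ hc
    rw [h.map] at h4 hdc
    have := hf.closed' (ρ k) (hm.lt_iff.1 h4) ((hl _).1 hdc.le)
    rw [hρ k] at this
    have := hl.lt_iff.1 h3
    order
  · obtain ⟨l, m, hl, hm, hf⟩ := h.feas _ hc
    obtain ⟨l', m', hl', hm', hf'⟩ := h.feas _ hd
    have hll := hl.mono hl' h3.le
    have hmm := hm.mono hm' h4.le
    have hml := hm'.mono hl hdc.le
    have key : l = l' → m = m' → ∃ l, Feas ρ l l ∧ ¬ Boxed ρ l ∧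
        ∀ x ∈ [a, b, c, d], x ∉ Set.range e ∧ InGap e l x := by
      rintro rfl rfl
      have hbox : ¬ Boxed ρ l := fun hbox =>
        absurd (h.dec l hbox c d hc hd hl hl' h3) h4.not_gt
      obtain rfl : l = m := by
        by_contra hlm
        exact hbox (hf.boxed hρ hL hlm)
      refine ⟨l, hf, hbox, ?_⟩
      have hk : ∀ k, e k < c → π d < π (e k) → k ≤ l ∧ l < ρ k := fun k h1 h2 => by
        rw [h.map] at h2
        exact ⟨(hl k).1 h1.le, hm'.lt_iff.1 h2⟩
      have hx : ∀ x, x ∉ Set.range e → x < c → π d < π x → InGap e l x ∧ InGap e l (π x) := by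
        intro x hx h1 h2
        obtain ⟨lx, mx, hlx, hmx, hfx⟩ := h.feas _ hx
        have i1 := hlx.mono hl h1.le
        have i2 := hm'.mono hmx h2.le
        rcases i1.eq_or_lt with rfl | i1
        · obtain rfl := hfx.unique hρ hL hf
          exact ⟨hlx, hmx⟩
        · obtain ⟨u, v, hcr, hv, hu⟩ := hfx.exists_crossing hρ hL (by order)
          exact absurd ⟨u, v, hcr, by order, by order⟩ hbox
      by_cases ha : a ∈ Set.range e <;> by_cases hb : b ∈ Set.range e
      · obtain ⟨a, rfl⟩ := ha
        obtain ⟨b, rfl⟩ := hb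
        have i1 := hk a (h1.trans h2) h5
        have i2 := hk b h2 (h5.trans h6)
        rw [h.map, h.map, elt] at h6
        exact absurd ⟨a, b, ⟨elt.1 h1, by order, h6⟩, i2.1, i1.2⟩ hbox
      · obtain ⟨a, rfl⟩ := ha
        have i1 := hk a (h1.trans h2) h5
        have i2 := hx b hb h2 (h5.trans h6)
        rw [h.map] at h6
        have := (i2.2 _).1 h6.le
        order
      · obtain ⟨b, rfl⟩ := hb
        have i1 := hx a ha (h1.trans h2) h5
        have i2 := hk b h2 (h5.trans h6)
        have := i1.1.lt_iff.1 h1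
        order
      · have i1 := hx a ha (h1.trans h2) h5
        have i2 := hx b hb h2 (h5.trans h6)
        simp only [List.mem_cons, List.not_mem_nil, or_false]
        rintro x (rfl | rfl | rfl | rfl)
        exacts [⟨ha, i1.1⟩, ⟨hb, i2.1⟩, ⟨hc, hl⟩, ⟨hd, hl'⟩]
    right
    rcases hll.eq_or_lt with rfl | hll
    · exact key rfl (hf.unique hρ hL hf')
    rcases hmm.eq_or_lt with rfl | hmm
    · exact key (hf.symm.unique hρ hL hf'.symm) rfl
    · exfalso
      obtain ⟨u, v, hcr, hv, hu⟩ := hf.symm.exists_crossing hρ hL (by order)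
      exact hf.symm.not_increasing hρ hL hf'.symm hmm hll hcr (by order) (by order)

/-- Every occurrence of `3412` lies in the copy of `ρ` or in a single cell. -/
theorem Fits.occ (h : Fits ρ π e) (hρ : Involutive ρ) (hL : Linked ρ) (hπ : Involutive π)
    {a b c d : Fin n} (ho : Occ π a b c d) :
    (∀ x ∈ [a, b, c, d], x ∈ Set.range e) ∨
      ∃ l, Feas ρ l l ∧ ¬ Boxed ρ l ∧ ∀ x ∈ [a, b, c, d], x ∉ Set.range e ∧ InGap e l x := by
  rcases ho.low_or hπ with hlow | hlow
  · exact h.occ_of_low hρ hL hπ ho hlow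
  have hmem := @map_mem_range_iff s n ρ π e hπ h.map
  have hlow' : π (π b) < π a := by rwa [hπ b]
  rcases h.occ_of_low hρ hL hπ (ho.inv hπ) hlow' with hK | ⟨l, hf, hbox, hx⟩
  · left
    simp only [List.mem_cons, List.not_mem_nil, or_false, forall_eq_or_imp, forall_eq, hmem]
      at hK ⊢
    tauto
  · right
    refine ⟨l, hf, hbox, ?_⟩
    have key : ∀ x, π x ∉ Set.range e ∧ InGap e l (π x) → x ∉ Set.range e ∧ InGap e l x := by
      rintro x ⟨h1, h2⟩
      rw [hmem] at h1
      obtain ⟨l', m, hl, hm, hf'⟩ := h.feas x h1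
      obtain rfl := hm.unique h2
      obtain rfl := hf.unique hρ hL hf'.symm
      exact ⟨h1, hl⟩
    simp only [List.mem_cons, List.not_mem_nil, or_false, forall_eq_or_imp, forall_eq] at hx
    simp only [List.mem_cons, List.not_mem_nil, or_false]
    rintro x (rfl | rfl | rfl | rfl)
    exacts [key _ hx.2.2.1, key _ hx.2.2.2, key _ hx.1, key _ hx.2.1]

end Fits

/-! ### Kernel embeddings are the fitting copies of linked involutions -/

section Kernel

variable {s n : ℕ} {ρ : Equiv.Perm (Fin s)} {π : Equiv.Perm (Fin n)} {e : Fin s → Fin n}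

theorem Occ.of_copy (he : StrictMono e) (hmap : ∀ k, π (e k) = e (ρ k)) {a b c d : Fin s} :
    Occ π (e a) (e b) (e c) (e d) ↔ Occ ρ a b c d := by
  simp only [Occ, hmap, he.lt_iff_lt]

/-- A two-cycle of `k` leaving the interval would cross that of `j`, giving a symmetric occurrence
with two copy entries. The assumption `hno` is weak enough to serve both kernels and the negation of
`Infeasible`; reflection supplies the other half of `Feas`. -/
theorem feas_half (he : StrictMono e) (hmap : ∀ k, π (e k) = e (ρ k)) (hπ : Involutive π)
    (hρ : Involutive ρ) {j : Fin n} {l m : Fin s} (hj : j ∉ Set.range e) (hl : InGap e l j)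
    (hm : InGap e m (π j))
    (hno : ∀ a b c d, Occ π a b c d → j ∈ [a, b, c, d] → ∀ x y, x ≠ y → e x ∈ [a, b, c, d] →
      e y ∈ [a, b, c, d] → False) :
    (∀ k, l < k → k ≤ m → l < ρ k ∧ ρ k ≤ m) ∧
    ∀ p u v, Crossing ρ u v → p < ρ u → v < ρ p → l < ρ u → v ≤ m →
      ¬ (p ≤ l ∧ ρ p ≤ m) ∧ ¬ (l < p ∧ m < ρ p) := by
  have hj' : π j ∉ Set.range e := by rwa [map_mem_range_iff hπ hmap]
  constructor
  · intro k hlk hkm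
    have h1 : j < e k := hl.lt_iff.2 hlk
    have h2 : e k < π j := (hm.iff_le hj').2 hkm
    by_contra hcl
    have hcl : ρ k ≤ l ∨ m < ρ k := by
      by_contra! h
      exact hcl h
    rcases hcl with hk | hk
    · have h3 : e (ρ k) < j := (hl.iff_le hj).2 hk
      have hc : Crossing π (e (ρ k)) j := by
        refine ⟨h3, ?_, ?_⟩ <;> rw [hmap, hρ k] <;> assumption
      refine hno _ _ _ _ (hc.occ hπ) (by simp) (ρ k) k (by order) (by simp) ?_
      simp [hmap, hρ k]
    · have h3 : π j < e (ρ k) := hm.lt_iff.2 hk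
      have hc : Crossing π j (e k) := by
        refine ⟨h1, h2, ?_⟩
        rwa [hmap]
      refine hno _ _ _ _ (hc.occ hπ) (by simp) k (ρ k) (by order) (by simp) ?_
      simp [hmap]
  · intro p u v huv h1 h2 h3 h4
    have h5 := huv
    obtain ⟨h6, h7, h8⟩ := huv
    have hcd : π (e (ρ u)) = e u ∧ π (e (ρ v)) = e v := by simp only [hmap, hρ _, and_self]
    have hne : ρ u ≠ ρ v := h8.ne
    constructor
    · rintro ⟨h9, h10⟩
      refine hno (e p) j (e (ρ u)) (e (ρ v)) ⟨(hl.iff_le hj).2 h9, hl.lt_iff.2 h3, he h8, ?_, ?_, ?_⟩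
        (by simp) (ρ u) (ρ v) hne (by simp) (by simp)
      · rw [hcd.1, hcd.2]; exact he h6
      · rw [hcd.2, hmap]; exact he h2
      · rw [hmap]; exact (hm.iff_le hj').2 h10
    · rintro ⟨h9, h10⟩
      refine hno j (e p) (e (ρ u)) (e (ρ v)) ⟨hl.lt_iff.2 h9, he h1, he h8, ?_, ?_, ?_⟩
        (by simp) (ρ u) (ρ v) hne (by simp) (by simp)
      · rw [hcd.1, hcd.2]; exact he h6
      · rw [hcd.2]; exact (hm.iff_le hj').2 h4
      · rw [hmap]; exact hm.lt_iff.2 h10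

/-- A cell is feasible if some entry in it belongs to no occurrence of `3412` containing two
entries of the copy of `ρ`. -/
theorem feas_of_entry (he : StrictMono e) (hmap : ∀ k, π (e k) = e (ρ k)) (hπ : Involutive π)
    (hρ : Involutive ρ) {j : Fin n} {l m : Fin s} (hj : j ∉ Set.range e) (hl : InGap e l j)
    (hm : InGap e m (π j))
    (hno : ∀ a b c d, Occ π a b c d → j ∈ [a, b, c, d] → ∀ x y, x ≠ y → e x ∈ [a, b, c, d] →
      e y ∈ [a, b, c, d] → False) : Feas ρ l m := by
  have hj' : π j ∉ Set.range e := by rwa [map_mem_range_iff hπ hmap]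
  have key : ∀ a b c d, Occ π a b c d → π j ∈ [a, b, c, d] → ∀ x y, x ≠ y → e x ∈ [a, b, c, d] →
      e y ∈ [a, b, c, d] → False := by
    intro a b c d ho hjm x y hxy hx hy
    have ht : ∀ z ∈ [a, b, c, d], π z ∈ [π c, π d, π a, π b] := by simp
    refine hno _ _ _ _ (ho.inv hπ) ?_ (ρ x) (ρ y) (ρ.injective.ne hxy) ?_ ?_
    · simpa only [hπ j] using ht _ hjm
    · simpa only [hmap] using ht _ hx
    · simpa only [hmap] using ht _ hy
  have h1 := feas_half he hmap hπ hρ hj hl hm hno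
  have h2 := feas_half he hmap hπ hρ hj' hm (by rwa [hπ j]) key
  exact ⟨h1.1, h2.1, h1.2, h2.2⟩

section IsKernelEmb

/-- `π` permutes the kernel positions; comparing the induced permutation with `ρ` gives an
increasing self-map of `Fin s`, hence the identity. -/
theorem IsKernelEmb.map (h : IsKernelEmb π ρ e) (hπ : Involutive π) (k : Fin s) :
    π (e k) = e (ρ k) := by
  obtain ⟨h1, h2, h3⟩ := h
  have hr : ∀ k, ∃ k', e k' = π (e k) := fun k => by
    have := (kernel_closed hπ).1 (e k) (by rw [← h2]; exact ⟨k, rfl⟩)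
    rwa [← h2] at this
  choose φ hφ using hr
  have hm : StrictMono fun k => φ (ρ.symm k) := by
    intro a b hab
    rw [← h1.lt_iff_lt, hφ, hφ, h3]
    simpa using hab
  have := (hm.range_inj strictMono_id).1 (by
    rw [Set.range_id, Set.range_eq_univ]
    exact Finite.surjective_of_injective hm.injective)
  have := congrFun this (ρ k)
  simp only [Equiv.symm_apply_apply, id] at this
  rw [← hφ, this]

theorem IsKernelEmb.involutive (h : IsKernelEmb π ρ e) (hπ : Involutive π) : Involutive ρ := by
  intro k
  apply h.1.injective
  rw [← h.map hπ, ← h.map hπ, hπ]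

theorem IsKernelEmb.pos (h : IsKernelEmb π ρ e) (hn : 0 < n) : 0 < s := by
  have : (⟨0, hn⟩ : Fin n) ∈ Set.range e := by
    rw [h.2.1]
    exact zero_mem_kernel π rfl
  obtain ⟨k, -⟩ := this
  exact k.pos

/-- The image under `e` of a closed set of letters of `ρ` is closed in `π`, so by minimality it
contains the kernel. -/
theorem IsKernelEmb.linked (h : IsKernelEmb π ρ e) (hπ : Involutive π) : Linked ρ := by
  have hmap := h.map hπ
  obtain ⟨he, hr, -⟩ := h
  intro S h0 hS ho x
  have := kernel_subset hπ (S := e '' S) ?_ ?_ ?_ (show e x ∈ kernel π by rw [← hr]; exact ⟨x, rfl⟩)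
  · obtain ⟨y, hy, hyx⟩ := this
    rwa [← he.injective hyx]
  · intro j hj
    obtain ⟨k, rfl⟩ : j ∈ Set.range e := by rw [hr]; exact zero_mem_kernel π hj
    refine ⟨k, h0 k ?_, rfl⟩
    by_contra hk
    have : e ⟨0, k.pos⟩ < e k := he (Nat.pos_of_ne_zero hk)
    rw [Fin.lt_def] at this
    omega
  · rintro _ ⟨k, hk, rfl⟩
    exact ⟨ρ k, hS k hk, (hmap k).symm⟩
  · intro a b c d hocc hm
    have hker : ∀ x ∈ e '' S, x ∈ kernel π := by
      rintro _ ⟨k, hk, rfl⟩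
      rw [← hr]
      exact ⟨k, rfl⟩
    have := (kernel_closed hπ).2 _ _ _ _ hocc
      (by rcases hm with h | h | h | h <;> have := hker _ h <;> tauto)
    rw [← hr] at this
    obtain ⟨⟨a, rfl⟩, ⟨b, rfl⟩, ⟨c, rfl⟩, ⟨d, rfl⟩⟩ := this
    simp only [he.injective.mem_set_image] at hm ⊢
    exact ho _ _ _ _ ((Occ.of_copy he hmap).1 hocc) hm

theorem IsKernelEmb.not_mixed (h : IsKernelEmb π ρ e) (hπ : Involutive π) {a b c d : Fin n}
    (ho : Occ π a b c d) {j : Fin n} (hj : j ∈ [a, b, c, d]) (hje : j ∉ Set.range e) {x : Fin s}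
    (hx : e x ∈ [a, b, c, d]) : False := by
  have hxk : e x ∈ kernel π := by rw [← h.2.1]; exact ⟨x, rfl⟩
  have := (kernel_closed hπ).2 _ _ _ _ ho (by
    simp only [List.mem_cons, List.not_mem_nil, or_false] at hx
    rcases hx with h | h | h | h <;> rw [h] at hxk <;> tauto)
  rw [h.2.1] at hje
  simp only [List.mem_cons, List.not_mem_nil, or_false] at hj
  rcases hj with rfl | rfl | rfl | rfl <;> tauto

theorem exists_inGap (he : StrictMono e) (h0 : ∀ j : Fin n, (j : ℕ) = 0 → j ∈ Set.range e)
    (j : Fin n) : ∃ l, InGap e l j := by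
  obtain ⟨k, hk⟩ := h0 ⟨0, j.pos⟩ rfl
  obtain ⟨l, hl, hmax⟩ := (Set.toFinite {k | e k ≤ j}).exists_maximal
    ⟨k, by rw [Set.mem_ofPred_eq, hk]; exact Nat.zero_le _⟩
  refine ⟨l, fun k => ⟨fun hk => ?_, fun hk => (he.monotone hk).trans hl⟩⟩
  rcases le_total k l with h | h
  exacts [h, hmax hk h]

/-- As no occurrence mixes kernel entries with others, occupied cells are feasible, and an ascent in
a boxed column is excluded: it would form an occurrence with the letters `ρ u`, `ρ v` of a crossing.
-/
theorem IsKernelEmb.fits (h : IsKernelEmb π ρ e) (hπ : Involutive π) : Fits ρ π e := by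
  have hmap := h.map hπ
  have hρ := h.involutive hπ
  have hL := h.linked hπ
  have hmem := @map_mem_range_iff s n ρ π e hπ hmap
  have hfeas : ∀ j, j ∉ Set.range e → ∃ l m, InGap e l j ∧ InGap e m (π j) ∧ Feas ρ l m := by
    intro j hj
    have h0 : ∀ j : Fin n, (j : ℕ) = 0 → j ∈ Set.range e := fun j hj => by
      rw [h.2.1]
      exact zero_mem_kernel π hj
    obtain ⟨l, hl⟩ := exists_inGap h.1 h0 j
    obtain ⟨m, hm⟩ := exists_inGap h.1 h0 (π j)
    exact ⟨l, m, hl, hm, feas_of_entry h.1 hmap hπ hρ hj hl hm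
      fun a b c d ho hjm x y _ hx _ => h.not_mixed hπ ho hjm hj hx⟩
  refine ⟨h.1, hmap, hfeas, ?_⟩
  intro l hbox j k hj hk hjl hkl hjk
  by_contra hlt
  have hlt : π j < π k := lt_of_le_of_ne (le_of_not_gt hlt) (π.injective.ne hjk.ne)
  obtain ⟨l', m, hjl', hm, hf⟩ := hfeas j hj
  obtain rfl := hjl'.unique hjl
  -- The crossing must lie below the row of the entries, not merely box the column; off the diagonal
  -- `Feas.exists_crossing` provides one.
  obtain ⟨u, v, hc, hv, hu⟩ : ∃ u v, Crossing ρ u v ∧ v ≤ m ∧ l' < ρ u := by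
    rcases lt_trichotomy l' m with hlm | rfl | hlm
    · obtain ⟨u, v, hc, hv, hu⟩ := hf.exists_crossing hρ hL hlm
      exact ⟨u, v, hc, by order, by order⟩
    · obtain ⟨u, v, hc, hv, hu⟩ := hbox
      exact ⟨u, v, hc, by order, by order⟩
    · exact hf.symm.exists_crossing hρ hL hlm
  obtain ⟨h6, h7, h8⟩ := hc
  refine h.not_mixed hπ (a := j) (b := k) (c := e (ρ u)) (d := e (ρ v))
    ⟨hjk, hkl.lt_iff.2 hu, h.1 h8, ?_, ?_, hlt⟩ (by simp) hj (x := ρ u) (by simp)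
  · rw [hmap, hmap, hρ, hρ]
    exact h.1 h6
  · rw [hmap, hρ]
    exact (hm.iff_le (by rwa [hmem])).2 hv

end IsKernelEmb

theorem Fits.zero_mem (h : Fits ρ π e) {j : Fin n} (hj : (j : ℕ) = 0) : j ∈ Set.range e := by
  by_contra hjr
  obtain ⟨l, -, hl, -⟩ := h.feas j hjr
  have := (hl l).2 le_rfl
  exact hjr ⟨l, by rw [Fin.le_def] at this; ext; omega⟩

theorem Fits.not_mixed (h : Fits ρ π e) (hρ : Involutive ρ) (hL : Linked ρ) (hπ : Involutive π)
    {a b c d : Fin n} (ho : Occ π a b c d) {j : Fin n} (hj : j ∈ [a, b, c, d])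
    (hjr : j ∈ Set.range e) : ∀ x ∈ [a, b, c, d], x ∈ Set.range e := by
  rcases h.occ hρ hL hπ ho with h | ⟨l, -, -, h⟩
  · exact h
  · exact absurd hjr (h j hj).1

/-- Occurrences meeting the copy stay in it, so minimality puts the kernel inside. Conversely the
kernel pulls back to a closed set of letters of `ρ`, which is everything by linkedness. -/
theorem Fits.isKernelEmb (h : Fits ρ π e) (hρ : Involutive ρ) (hL : Linked ρ) (hπ : Involutive π) :
    IsKernelEmb π ρ e := by
  refine ⟨h.mono, subset_antisymm ?_ ?_, fun a b => by rw [h.map, h.map, h.mono.lt_iff_lt]⟩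
  · rintro _ ⟨k, rfl⟩
    refine hL {k | e k ∈ kernel π} ?_ ?_ ?_ k
    · intro k hk
      refine zero_mem_kernel π ?_
      obtain ⟨k', hk'⟩ := h.zero_mem (j := ⟨0, (e k).pos⟩) rfl
      have := h.mono.monotone (show k ≤ k' by rw [Fin.le_def]; omega)
      rw [hk', Fin.le_def] at this
      exact Nat.le_zero.1 this
    · intro k hk
      have := (kernel_closed hπ).1 _ hk
      rwa [h.map] at this
    · intro a b c d ho hm
      exact (kernel_closed hπ).2 _ _ _ _ ((Occ.of_copy h.mono h.map).2 ho) hm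
  · refine kernel_subset hπ (fun j hj => h.zero_mem hj)
      (fun x hx => (map_mem_range_iff hπ h.map).2 hx) ?_
    intro a b c d ho hm
    have : ∀ x ∈ [a, b, c, d], x ∈ Set.range e := by
      rcases hm with hm | hm | hm | hm <;> exact h.not_mixed hρ hL hπ ho (by simp) hm
    exact ⟨this a (by simp), this b (by simp), this c (by simp), this d (by simp)⟩

end Kernel

/-! ### Layouts: positions split into base letters and blocks -/

/-- The positions of `n` letters listed as `s` letters `base i`, the `i`-th of which is followed by
a block of `g i` letters `inner i t`. -/
structure Layout {s : ℕ} (g : Fin s → ℕ) (n : ℕ) where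
  /-- The letter of index `t` in the group consisting of the `i`-th base letter and its block. -/
  pos : (i : Fin s) → Fin (g i + 1) → Fin n
  lt_iff : ∀ {i i'} {t : Fin (g i + 1)} {t' : Fin (g i' + 1)},
    pos i t < pos i' t' ↔ i < i' ∨ i = i' ∧ (t : ℕ) < t'
  surj : ∀ j, ∃ i t, pos i t = j

namespace Layout

variable {s n : ℕ} {g : Fin s → ℕ} (L : Layout g n)

def base (i : Fin s) : Fin n := L.pos i 0

def inner (i : Fin s) (t : Fin (g i)) : Fin n := L.pos i t.succ

theorem pos_congr {i i' : Fin s} {t : Fin (g i + 1)} {t' : Fin (g i' + 1)} (h : i = i')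
    (ht : (t : ℕ) = t') : L.pos i t = L.pos i' t' := by
  subst h
  rw [Fin.ext ht]

theorem pos_inj {i i' : Fin s} {t : Fin (g i + 1)} {t' : Fin (g i' + 1)} :
    L.pos i t = L.pos i' t' ↔ i = i' ∧ (t : ℕ) = t' := by
  refine ⟨fun h => ?_, fun h => L.pos_congr h.1 h.2⟩
  have h1 := h.not_lt
  have h2 := h.symm.not_lt
  rw [L.lt_iff] at h1 h2
  push Not at h1 h2
  have := le_antisymm h2.1 h1.1
  exact ⟨this, le_antisymm (h2.2 this.symm) (h1.2 this)⟩

noncomputable def equiv : (Σ i, Fin (g i + 1)) ≃ Fin n :=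
  Equiv.ofBijective (fun x => L.pos x.1 x.2) <| by
    constructor
    · rintro ⟨i, t⟩ ⟨i', t'⟩ h
      obtain ⟨rfl, ht⟩ := L.pos_inj.1 h
      exact congrArg (Sigma.mk i) (Fin.ext ht)
    · intro j
      obtain ⟨i, t, h⟩ := L.surj j
      exact ⟨⟨i, t⟩, h⟩

theorem sum_eq {M : Type*} [AddCommMonoid M] (f : Fin n → M) :
    ∑ j, f j = ∑ i, (f (L.base i) + ∑ t, f (L.inner i t)) := by
  rw [← L.equiv.sum_comp, Fintype.sum_sigma]
  refine sum_congr rfl fun i _ => ?_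
  rw [Fin.sum_univ_succ]
  rfl

theorem sum_card (L : Layout g n) : ∑ i, (g i + 1) = n := by
  have := Fintype.card_congr L.equiv
  simpa using this

theorem base_strictMono : StrictMono L.base := fun _ _ h => L.lt_iff.2 (.inl h)

theorem inner_congr {i i' : Fin s} {t : Fin (g i)} {t' : Fin (g i')} (h : i = i')
    (ht : (t : ℕ) = t') : L.inner i t = L.inner i' t' :=
  L.pos_congr h (by simp [ht])

theorem inner_inj {i i' : Fin s} {t : Fin (g i)} {t' : Fin (g i')} :
    L.inner i t = L.inner i' t' ↔ i = i' ∧ (t : ℕ) = t' := by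
  simp [inner, pos_inj]

theorem inner_lt {i : Fin s} {t t' : Fin (g i)} : L.inner i t < L.inner i t' ↔ t < t' := by
  simp [inner, L.lt_iff]

theorem inner_notMem (i : Fin s) (t : Fin (g i)) : L.inner i t ∉ Set.range L.base := by
  rintro ⟨k, hk⟩
  have := (L.pos_inj.1 hk).2
  simp at this

theorem inGap_inner (i : Fin s) (t : Fin (g i)) : InGap L.base i (L.inner i t) := by
  intro k
  rw [← not_lt, base, inner, L.lt_iff]
  simp only [Fin.val_zero, not_lt_zero, and_false, or_false, not_lt]

theorem eq_inner {j : Fin n} {i : Fin s} (hj : j ∉ Set.range L.base) (hi : InGap L.base i j) :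
    ∃ t, L.inner i t = j := by
  obtain ⟨i', t, rfl⟩ := L.surj j
  induction t using Fin.cases with
  | zero => exact absurd ⟨i', rfl⟩ hj
  | succ t =>
    obtain rfl := hi.unique (L.inGap_inner i' t)
    exact ⟨t, rfl⟩

theorem cases (j : Fin n) : (∃ i, L.base i = j) ∨ ∃ i t, L.inner i t = j := by
  obtain ⟨i, t, rfl⟩ := L.surj j
  induction t using Fin.cases with
  | zero => exact .inl ⟨i, rfl⟩
  | succ t => exact .inr ⟨i, t, rfl⟩

/-- Both are increasing enumerations of the lexicographic sum with the same range; thus the block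
sizes alone determine the layout. -/
theorem unique (L L' : Layout g n) : L.pos = L'.pos := by
  have key : ∀ L : Layout g n, StrictMono fun x : Σₗ i, Fin (g i + 1) =>
      L.pos (ofLex x).1 (ofLex x).2 := by
    rintro L ⟨i, t⟩ ⟨i', t'⟩ h
    refine L.lt_iff.2 ?_
    rcases Sigma.Lex.lt_def.1 h with h | ⟨h, h'⟩
    · exact .inl h
    · dsimp only at h h'
      subst h
      exact .inr ⟨rfl, h'⟩
  have hr : ∀ L : Layout g n, Set.range (fun x : Σₗ i, Fin (g i + 1) =>
      L.pos (ofLex x).1 (ofLex x).2) = Set.univ := fun L => Set.range_eq_univ.2 fun j => by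
    obtain ⟨i, t, h⟩ := L.surj j
    exact ⟨toLex ⟨i, t⟩, h⟩
  have := ((key L).range_inj (key L')).1 ((hr L).trans (hr L').symm)
  funext i t
  exact congrFun this (toLex ⟨i, t⟩)

theorem exists_of_sum (g : Fin s → ℕ) (hn : ∑ i, (g i + 1) = n) : Nonempty (Layout g n) := by
  have hc : Fintype.card (Σₗ i, Fin (g i + 1)) = n := by
    rw [← hn]
    exact (Fintype.card_sigma (α := fun i => Fin (g i + 1))).trans (by simp)
  let θ := Fintype.orderIsoFinOfCardEq _ hc
  refine ⟨⟨fun i t => θ.symm (toLex ⟨i, t⟩), ?_, ?_⟩⟩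
  · intro i i' t t'
    rw [θ.symm.lt_iff_lt, Sigma.Lex.lt_def]
    refine or_congr Iff.rfl ⟨?_, ?_⟩
    · rintro ⟨h, h'⟩
      change i = i' at h
      subst h
      exact ⟨rfl, h'⟩
    · rintro ⟨rfl, h⟩
      exact ⟨rfl, h⟩
  · intro j
    exact ⟨(ofLex (θ j)).1, (ofLex (θ j)).2, θ.symm_apply_apply j⟩

open Classical in
/-- Every increasing list of positions beginning with the first one consists of the base letters
of a layout. -/
theorem exists_of_strictMono {e : Fin s → Fin n} (he : StrictMono e)
    (h0 : ∀ j : Fin n, (j : ℕ) = 0 → j ∈ Set.range e) :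
    ∃ (g : Fin s → ℕ) (L : Layout g n), L.base = e := by
  let B : Fin s → Finset (Fin n) := fun i => {j | InGap e i j}
  have hB : ∀ i j, j ∈ B i ↔ InGap e i j := fun i j => by simp [B]
  have heB : ∀ i, e i ∈ B i := fun i => (hB _ _).2 fun k => he.le_iff_le
  -- `B i` contains `e i` itself, so the block proper has one letter fewer.
  have hcard : ∀ i, (B i).card = (B i).card - 1 + 1 := fun i =>
    (Nat.sub_add_cancel (card_pos.2 ⟨_, heB i⟩)).symm
  let L : Layout (fun i => (B i).card - 1) n :=
    { pos := fun i t => (B i).orderEmbOfFin (hcard i) t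
      lt_iff := by
        intro i i' t t'
        have m : InGap e i ((B i).orderEmbOfFin (hcard i) t) :=
          (hB _ _).1 (orderEmbOfFin_mem _ (hcard i) t)
        have m' : InGap e i' ((B i').orderEmbOfFin (hcard i') t') :=
          (hB _ _).1 (orderEmbOfFin_mem _ (hcard i') t')
        rcases lt_trichotomy i i' with h | h | h
        · refine iff_of_true (lt_of_not_ge fun hle => ?_) (.inl h)
          exact absurd (m'.mono m hle) (not_le.2 h)
        · subst h
          simp
        · refine iff_of_false (fun hlt => ?_) ?_
          · exact absurd (m.mono m' hlt.le) (not_le.2 h)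
          · rintro (h' | ⟨rfl, -⟩)
            exacts [absurd h h'.not_gt, absurd h (lt_irrefl _)]
      surj := by
        intro j
        obtain ⟨l, hl⟩ := exists_inGap he h0 j
        have : j ∈ Set.range ((B l).orderEmbOfFin (hcard l)) := by
          rw [range_orderEmbOfFin]
          exact (hB _ _).2 hl
        obtain ⟨t, ht⟩ := this
        exact ⟨l, t, ht⟩ }
  refine ⟨_, L, funext fun i => ?_⟩
  have : L.base i = (B i).min' ⟨_, heB i⟩ := orderEmbOfFin_zero (hcard i) (Nat.succ_pos _)
  rw [this]
  refine le_antisymm (min'_le _ _ (heB i)) (le_min' _ _ _ fun j hj => ?_)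
  exact ((hB _ _).1 hj i).2 le_rfl

theorem base_injective {g' : Fin s → ℕ} (L' : Layout g' n) (h : L.base = L'.base) : g = g' := by
  have key : ∀ {g g' : Fin s → ℕ} (L : Layout g n) (L' : Layout g' n), L.base = L'.base →
      ∀ i, g i ≤ g' i := by
    intro g g' L L' h i
    have hex : ∀ t, ∃ t', L'.inner i t' = L.inner i t := fun t =>
      L'.eq_inner (h ▸ L.inner_notMem i t) (h ▸ L.inGap_inner i t)
    choose φ hφ using hex
    have : Injective φ := fun a b hab => by
      have := (hφ a).symm.trans ((congrArg _ hab).trans (hφ b))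
      exact Fin.ext (L.inner_inj.1 this).2
    simpa using Fintype.card_le_of_injective φ this
  exact funext fun i => le_antisymm (key L L' h i) (key L' L h.symm i)

end Layout

/-! ### Building involutions from fillings, and back -/

section Filling

variable {s n : ℕ} {ρ : Equiv.Perm (Fin s)} {π : Equiv.Perm (Fin n)} {g : Fin s → ℕ}

/-- The feasible cell in the column after the letter `i` is the one on the diagonal, and it may be
filled by an arbitrary involution. -/
def Free (ρ : Equiv.Perm (Fin s)) (i : Fin s) : Prop := Feas ρ i i ∧ ¬ Boxed ρ i

open Classical in
/-- The row of the feasible cell in the column after the letter `i`. -/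
noncomputable def partner (ρ : Equiv.Perm (Fin s)) (i : Fin s) : Fin s :=
  -- The default `i` makes `partner` an involution on all columns; `Compat.feas` keeps the columns
  -- without a feasible cell empty.
  if h : ∃ m, Feas ρ i m then h.choose else i

theorem feas_partner {i : Fin s} (h : ∃ m, Feas ρ i m) : Feas ρ i (partner ρ i) := by
  rw [partner, dif_pos h]
  exact h.choose_spec

theorem Feas.partner_eq (hρ : Involutive ρ) (hL : Linked ρ) {i m : Fin s} (h : Feas ρ i m) :
    partner ρ i = m :=
  (feas_partner ⟨m, h⟩).unique hρ hL h

theorem partner_of_not {i : Fin s} (h : ¬ ∃ m, Feas ρ i m) : partner ρ i = i := dif_neg h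

theorem partner_partner (hρ : Involutive ρ) (hL : Linked ρ) (i : Fin s) :
    partner ρ (partner ρ i) = i := by
  by_cases h : ∃ m, Feas ρ i m
  · exact (feas_partner h).symm.partner_eq hρ hL
  · rw [partner_of_not h, partner_of_not h]

theorem Free.partner_eq (hρ : Involutive ρ) (hL : Linked ρ) {i : Fin s} (h : Free ρ i) :
    partner ρ i = i :=
  h.1.partner_eq hρ hL

theorem boxed_of_not_free (hρ : Involutive ρ) (hL : Linked ρ) {i m : Fin s} (h : Feas ρ i m)
    (hi : ¬ Free ρ i) : Boxed ρ i := by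
  by_contra hb
  by_cases him : i = m
  · subst him
    exact hi ⟨h, hb⟩
  · exact hb (h.boxed hρ hL him)

/-- The block sizes that occur in involutions with kernel shape `ρ`. -/
structure Compat (ρ : Equiv.Perm (Fin s)) (g : Fin s → ℕ) : Prop where
  partner : ∀ i, g (partner ρ i) = g i
  feas : ∀ i, g i ≠ 0 → ∃ m, Feas ρ i m

open Classical in
/-- The permutations of `k` letters that may fill the feasible cell in the column after `i`. -/
noncomputable def fillings (ρ : Equiv.Perm (Fin s)) (i : Fin s) (k : ℕ) :
    Finset (Equiv.Perm (Fin k)) :=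
  if Free ρ i then univ.filter fun σ => Involutive σ else {Fin.revPerm}

theorem mem_fillings_of_free {i : Fin s} (h : Free ρ i) {k : ℕ} {σ : Equiv.Perm (Fin k)} :
    σ ∈ fillings ρ i k ↔ Involutive σ := by
  simp [fillings, h]

theorem mem_fillings_of_not_free {i : Fin s} (h : ¬ Free ρ i) {k : ℕ} {σ : Equiv.Perm (Fin k)} :
    σ ∈ fillings ρ i k ↔ σ = Fin.revPerm := by
  simp [fillings, h]

theorem involutive_of_mem_fillings {i : Fin s} {k : ℕ} {σ : Equiv.Perm (Fin k)}
    (h : σ ∈ fillings ρ i k) : Involutive σ := by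
  by_cases hi : Free ρ i
  · exact (mem_fillings_of_free hi).1 h
  · rw [(mem_fillings_of_not_free hi).1 h]
    exact Fin.rev_rev

/-- The involution `π` is built from `ρ` by filling each feasible cell according to `σ`. -/
structure Built (L : Layout g n) (ρ : Equiv.Perm (Fin s)) (σ : ∀ i, Equiv.Perm (Fin (g i)))
    (π : Equiv.Perm (Fin n)) : Prop where
  compat : Compat ρ g
  base : ∀ i, π (L.base i) = L.base (ρ i)
  inner : ∀ i t, π (L.inner i t) = L.inner (partner ρ i) (Fin.cast (compat.partner i).symm (σ i t))
  mem : ∀ i, σ i ∈ fillings ρ i (g i)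

/-- The map so defined is an involution: a free column is its own partner and carries an involution,
and elsewhere the reversals in a column and its partner cancel. -/
theorem exists_built (hρ : Involutive ρ) (hL : Linked ρ) (L : Layout g n) (hg : Compat ρ g)
    (σ : ∀ i, Equiv.Perm (Fin (g i))) (hσ : ∀ i, σ i ∈ fillings ρ i (g i)) :
    ∃ π : Equiv.Perm (Fin n), Involutive π ∧ Built L ρ σ π := by
  let φ : (Σ i, Fin (g i + 1)) → Σ i, Fin (g i + 1) := fun x =>
    Fin.cases (motive := fun _ => Σ i, Fin (g i + 1)) ⟨ρ x.1, 0⟩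
      (fun t => ⟨partner ρ x.1, (Fin.cast (hg.partner x.1).symm (σ x.1 t)).succ⟩) x.2
  let F : Fin n → Fin n := fun j => L.equiv (φ (L.equiv.symm j))
  have hsymm : ∀ i t, L.equiv.symm (L.pos i t) = ⟨i, t⟩ := fun i t => L.equiv.symm_apply_apply ⟨i, t⟩
  have hbase : ∀ i, F (L.base i) = L.base (ρ i) := fun i => by
    simp only [F, Layout.base, hsymm]
    rfl
  have hinner : ∀ i t, F (L.inner i t) =
      L.inner (partner ρ i) (Fin.cast (hg.partner i).symm (σ i t)) := fun i t => by
    simp only [F, Layout.inner, hsymm]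
    rfl
  have hF : Involutive F := by
    intro j
    rcases L.cases j with ⟨i, rfl⟩ | ⟨i, t, rfl⟩
    · rw [hbase, hbase, hρ]
    · rw [hinner, hinner]
      refine L.inner_congr (partner_partner hρ hL i) ?_
      have hinv := involutive_of_mem_fillings (hσ i) t
      by_cases hi : Free ρ i
      · have key : ∀ i' (h : i = i') (hc : g i = g i') (t : Fin (g i)),
            (σ i' (Fin.cast hc t) : ℕ) = σ i t := by
          rintro i' rfl hc t
          rfl
        rw [Fin.val_cast, key _ (hi.partner_eq hρ hL).symm, hinv]
      · have hi' : ¬ Free ρ (partner ρ i) := fun h => by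
          have := h.partner_eq hρ hL
          rw [partner_partner hρ hL] at this
          rw [← this] at h
          exact hi h
        rw [(mem_fillings_of_not_free hi).1 (hσ i), (mem_fillings_of_not_free hi').1 (hσ _)]
        have := t.2
        simp only [Fin.revPerm_apply, Fin.val_cast, Fin.val_rev, hg.partner i]
        omega
  exact ⟨hF.toPerm, hF, hg, hbase, hinner, hσ⟩

theorem Built.unique {L : Layout g n} {σ : ∀ i, Equiv.Perm (Fin (g i))}
    {π' : Equiv.Perm (Fin n)} (h : Built L ρ σ π) (h' : Built L ρ σ π') : π = π' := by
  ext j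
  rcases L.cases j with ⟨i, rfl⟩ | ⟨i, t, rfl⟩
  · rw [h.base, h'.base]
  · rw [h.inner, h'.inner]

theorem Built.filling_unique {L : Layout g n} {σ σ' : ∀ i, Equiv.Perm (Fin (g i))}
    (h : Built L ρ σ π) (h' : Built L ρ σ' π) : σ = σ' := by
  funext i
  ext t
  have := (h.inner i t).symm.trans (h'.inner i t)
  exact (L.inner_inj.1 this).2

theorem Built.inner_of_free (hρ : Involutive ρ) (hL : Linked ρ) {L : Layout g n}
    {σ : ∀ i, Equiv.Perm (Fin (g i))} (h : Built L ρ σ π) {i : Fin s} (hi : Free ρ i)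
    (t : Fin (g i)) : π (L.inner i t) = L.inner i (σ i t) := by
  rw [h.inner]
  exact L.inner_congr (hi.partner_eq hρ hL) rfl

theorem Built.fits {L : Layout g n} {σ : ∀ i, Equiv.Perm (Fin (g i))} (h : Built L ρ σ π) :
    Fits ρ π L.base := by
  refine ⟨L.base_strictMono, h.base, ?_, ?_⟩
  · intro j hj
    rcases L.cases j with ⟨i, rfl⟩ | ⟨i, t, rfl⟩
    · exact absurd ⟨i, rfl⟩ hj
    · refine ⟨i, partner ρ i, L.inGap_inner i t, ?_, feas_partner (h.compat.feas i ?_)⟩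
      · rw [h.inner]
        exact L.inGap_inner _ _
      · have := t.2
        omega
  · intro l hl j k hj hk hjl hkl hjk
    obtain ⟨t, rfl⟩ := L.eq_inner hj hjl
    obtain ⟨t', rfl⟩ := L.eq_inner hk hkl
    rw [L.inner_lt] at hjk
    rw [h.inner, h.inner, L.inner_lt, (mem_fillings_of_not_free fun hf => hf.2 hl).1 (h.mem l)]
    simpa [Fin.lt_def] using Fin.rev_lt_rev.2 hjk

/-- `π` injects each block into its partner block, so the two sizes agree because `partner` is an
involution. In a non-free column the order condition leaves only the reversal. -/
theorem Fits.built {L : Layout g n} (h : Fits ρ π L.base) (hρ : Involutive ρ) (hL : Linked ρ)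
    (hπ : Involutive π) : ∃ σ, Built L ρ σ π := by
  have hex : ∀ i t, Feas ρ i (partner ρ i) ∧
      ∃ t', L.inner (partner ρ i) t' = π (L.inner i t) := fun i t => by
    obtain ⟨l, m, hl, hm, hf⟩ := h.feas _ (L.inner_notMem i t)
    obtain rfl := hl.unique (L.inGap_inner i t)
    obtain rfl := hf.partner_eq hρ hL
    exact ⟨hf, L.eq_inner (by rw [map_mem_range_iff hπ h.map]; exact L.inner_notMem _ t) hm⟩
  choose hfeas φ hφ using hex
  have hinj : ∀ i, Injective (φ i) := fun i a b hab => by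
    have := (hφ i a).symm.trans ((congrArg _ hab).trans (hφ i b))
    exact Fin.ext (L.inner_inj.1 (π.injective this)).2
  have hle : ∀ i, g i ≤ g (partner ρ i) := fun i => by
    simpa using Fintype.card_le_of_injective _ (hinj i)
  have hg : Compat ρ g := by
    refine ⟨fun i => le_antisymm ?_ (hle i), fun i hi => ⟨_, hfeas i ⟨0, Nat.pos_of_ne_zero hi⟩⟩⟩
    simpa only [partner_partner hρ hL] using hle (partner ρ i)
  let τ : ∀ i, Fin (g i) → Fin (g i) := fun i t => Fin.cast (hg.partner i) (φ i t)
  have hτ : ∀ i, Injective (τ i) := fun i => (Fin.cast_injective _).comp (hinj i)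
  let σ : ∀ i, Equiv.Perm (Fin (g i)) := fun i =>
    Equiv.ofBijective (τ i) ⟨hτ i, Finite.surjective_of_injective (hτ i)⟩
  have hinner : ∀ i t, π (L.inner i t) =
      L.inner (partner ρ i) (Fin.cast (hg.partner i).symm (σ i t)) := fun i t => (hφ i t).symm
  refine ⟨σ, hg, h.map, hinner, fun i => ?_⟩
  by_cases hi : Free ρ i
  · rw [mem_fillings_of_free hi]
    intro t
    have key : ∀ t, π (L.inner i t) = L.inner i (σ i t) := fun t => by
      rw [hinner]
      exact L.inner_congr (hi.partner_eq hρ hL) rfl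
    have := hπ (L.inner i t)
    rw [key, key] at this
    exact Fin.ext (L.inner_inj.1 this).2
  · rw [mem_fillings_of_not_free hi]
    have hm : StrictMono fun t => Fin.rev (σ i t) := by
      intro t t' htt
      have := h.dec i (boxed_of_not_free hρ hL (hfeas i t) hi) _ _ (L.inner_notMem i t)
        (L.inner_notMem i t') (L.inGap_inner i t) (L.inGap_inner i t') (L.inner_lt.2 htt)
      rw [hinner, hinner, L.inner_lt] at this
      exact Fin.rev_lt_rev.2 this
    have := (hm.range_inj strictMono_id).1 (by
      rw [Set.range_id, Set.range_eq_univ]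
      exact Finite.surjective_of_injective hm.injective)
    ext t
    have ht := congrFun this t
    simp only [id] at ht
    rw [Fin.revPerm_apply, ← ht, Fin.rev_rev, ht]

end Filling

/-! ### The defined cell classes in terms of `Feas`, `Boxed` and `partner` -/

section Cells

variable {s n : ℕ} {ρ : Equiv.Perm (Fin s)} {π : Equiv.Perm (Fin n)} {e : Fin s → Fin n}

theorem inGap_iff (he : StrictMono e) {l : Fin s} {j : Fin n} :
    (j ∉ Set.range e ∧ InGap e l j) ↔ e l < j ∧ ∀ h : (l : ℕ) + 1 < s, j < e ⟨l + 1, h⟩ := by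
  constructor
  · rintro ⟨hj, hl⟩
    refine ⟨(hl.iff_le hj).2 le_rfl, fun h => hl.lt_iff.2 ?_⟩
    rw [Fin.lt_def]
    exact Nat.lt_succ_self _
  · rintro ⟨h1, h2⟩
    have hgt : ∀ k, l < k → j < e k := fun k hk => by
      rw [Fin.lt_def] at hk
      exact (h2 (by omega)).trans_le (he.monotone (by rw [Fin.le_def]; exact hk))
    have hle : ∀ k, k ≤ l → e k < j := fun k hk => (he.monotone hk).trans_lt h1
    constructor
    · rintro ⟨k, rfl⟩
      rcases le_or_gt k l with h | h
      exacts [(hle k h).false, (hgt k h).false]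
    · exact fun k => ⟨fun hk => le_of_not_gt fun hlk => (hgt k hlk).not_ge hk, fun hk => (hle k hk).le⟩

theorem mem_cell (he : StrictMono e) (hmap : ∀ k, π (e k) = e (ρ k)) (hπ : Involutive π)
    {l m : Fin s} {j : Fin n} :
    j ∈ cell ρ π e m l ↔ j ∉ Set.range e ∧ InGap e l j ∧ InGap e m (π j) := by
  have h1 := inGap_iff he (l := l) (j := j)
  have h2 := inGap_iff he (l := m) (j := π j)
  have h3 := @map_mem_range_iff s n ρ π e hπ hmap j
  simp only [cell, Set.mem_ofPred_eq, hmap, Equiv.apply_symm_apply]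
  rw [h3] at h2
  tauto

theorem revPerm_mem_fillings (i : Fin s) (k : ℕ) : Fin.revPerm ∈ fillings ρ i k := by
  by_cases hi : Free ρ i
  · exact (mem_fillings_of_free hi).2 Fin.rev_rev
  · exact (mem_fillings_of_not_free hi).2 rfl

theorem feas_of_not_infeasible (hρ : Involutive ρ) {l m : Fin s} (h : ¬ Infeasible ρ m l) :
    Feas ρ l m := by
  simp only [Infeasible, not_forall] at h
  obtain ⟨n, π, e, hπ, he, hmap, j, hj, hno⟩ := h
  obtain ⟨hj, hl, hm⟩ := (mem_cell he hmap hπ).1 hj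
  refine feas_of_entry he hmap hπ hρ hj hl hm fun a b c d ho hja x y hxy hx hy => hno ?_
  have hr : ∀ z ∈ [a, b, c, d], z ∈ Set.range ![a, b, c, d] := fun z hz => by
    rw [range_fin_four]
    simpa using hz
  exact ⟨![a, b, c, d], mem_occurrences_cons.2 ho, x, y, hxy, hr _ hja, hr _ hx, hr _ hy⟩

theorem not_infeasible_iff (hρ : Involutive ρ) (hL : Linked ρ) {l m : Fin s} :
    ¬ Infeasible ρ m l ↔ Feas ρ l m := by
  refine ⟨feas_of_not_infeasible hρ, fun hf hinf => ?_⟩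
  -- One entry in the cell and one in its mirror image (the same one on the diagonal): by
  -- `Fits.not_mixed` it shares no occurrence with the copy.
  let g : Fin s → ℕ := fun i => if i = l ∨ i = m then 1 else 0
  have h1 := hf.partner_eq hρ hL
  have h2 := hf.symm.partner_eq hρ hL
  have hg : Compat ρ g := by
    constructor
    · intro i
      have : partner ρ i = l ∨ partner ρ i = m ↔ i = l ∨ i = m := by
        constructor
        · rintro (h | h)
          · rw [← partner_partner hρ hL i, h, h1]; exact .inr rfl
          · rw [← partner_partner hρ hL i, h, h2]; exact .inl rfl
        · rintro (rfl | rfl)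
          exacts [.inr h1, .inl h2]
      simp only [g, this]
    · intro i hi
      have : i = l ∨ i = m := by
        by_contra hc
        exact hi (if_neg hc)
      rcases this with rfl | rfl
      exacts [⟨_, hf⟩, ⟨_, hf.symm⟩]
  obtain ⟨L⟩ := Layout.exists_of_sum g rfl
  obtain ⟨π, hπ, hb⟩ := exists_built hρ hL L hg (fun _ => Fin.revPerm)
    fun i => revPerm_mem_fillings i _
  have hl : 0 < g l := by simp [g]
  have hfit := hb.fits
  obtain ⟨o, ho, x, y, -, hj, hx, -⟩ := hinf _ π L.base hπ hfit.mono hfit.map (L.inner l ⟨0, hl⟩)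
    ((mem_cell hfit.mono hfit.map hπ).2 ⟨L.inner_notMem _ _, L.inGap_inner _ _, by
      rw [hb.inner, ← h1]; exact L.inGap_inner _ _⟩)
  rw [range_fin_four] at hj hx
  exact L.inner_notMem l ⟨0, hl⟩ (hfit.not_mixed hρ hL hπ (mem_occurrences.1 ho)
    (j := L.base x) (by simpa using hx) ⟨x, rfl⟩ _ (by simpa using hj))

theorem forcedDecreasing_iff (hρ : Involutive ρ) (hL : Linked ρ) {l m : Fin s} (hf : Feas ρ l m) :
    ForcedDecreasing ρ m l ↔ Boxed ρ l := by
  constructor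
  · intro hfd
    by_contra hbox
    obtain rfl : l = m := by
      by_contra hlm
      exact hbox (hf.boxed hρ hL hlm)
    have hfree : Free ρ l := ⟨hf, hbox⟩
    -- Two fixed points in an unboxed diagonal cell are an admissible ascent.
    let g : Fin s → ℕ := fun i => if i = l then 2 else 0
    have h1 := hf.partner_eq hρ hL
    have hg : Compat ρ g := by
      constructor
      · intro i
        have : partner ρ i = l ↔ i = l := by
          constructor
          · intro h
            rw [← partner_partner hρ hL i, h, h1]
          · rintro rfl
            exact h1
        simp only [g, this]
      · intro i hi
        obtain rfl : i = l := by
          by_contra hc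
          exact hi (if_neg hc)
        exact ⟨_, hf⟩
    obtain ⟨L⟩ := Layout.exists_of_sum g rfl
    obtain ⟨π, hπ, hb⟩ := exists_built hρ hL L hg
      (fun i => if i = l then Equiv.refl _ else Fin.revPerm) (fun i => by
        split_ifs with hi
        · subst hi
          exact (mem_fillings_of_free hfree).2 fun _ => rfl
        · exact revPerm_mem_fillings i _)
    have hl : g l = 2 := by simp [g]
    have hfit := hb.fits
    have hπ' : ∀ t, π (L.inner l t) = L.inner l t := fun t => by
      rw [hb.inner_of_free hρ hL hfree]
      simp
    have hcell : ∀ t, L.inner l t ∈ cell ρ π L.base l l := fun t =>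
      (mem_cell hfit.mono hfit.map hπ).2
        ⟨L.inner_notMem _ _, L.inGap_inner _ _, by rw [hπ']; exact L.inGap_inner _ _⟩
    have hlt : L.inner l ⟨0, by omega⟩ < L.inner l ⟨1, by omega⟩ := by
      rw [L.inner_lt]
      exact Nat.zero_lt_one
    have := hfd _ π L.base hπ (hfit.isKernelEmb hρ hL hπ) _ (hcell _) _ (hcell _) hlt
    rw [hπ', hπ'] at this
    exact this.not_gt hlt
  · intro hbox n π e hπ he j hj k hk hjk
    have hmap := he.map hπ
    obtain ⟨h1, h2, -⟩ := (mem_cell he.1 hmap hπ).1 hj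
    obtain ⟨h3, h4, -⟩ := (mem_cell he.1 hmap hπ).1 hk
    exact (he.fits hπ).dec l hbox j k h1 h3 h2 h4 hjk

open Classical in
theorem numFree_eq (hρ : Involutive ρ) (hL : Linked ρ) : numFree ρ = #{i | Free ρ i} := by
  refine card_bij' (fun c _ => c.1) (fun i _ => (i, i)) ?_ ?_ ?_ ?_
  all_goals simp only [mem_filter, mem_univ, true_and, not_infeasible_iff hρ hL, Prod.forall]
  · rintro m l ⟨h1, h2⟩
    rw [forcedDecreasing_iff hρ hL h1] at h2
    obtain rfl : l = m := by
      by_contra hlm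
      exact h2 (h1.boxed hρ hL hlm)
    exact ⟨h1, h2⟩
  · rintro i ⟨h1, h2⟩
    rw [forcedDecreasing_iff hρ hL h1]
    exact ⟨h1, h2⟩
  · rintro m l ⟨h1, h2⟩
    rw [forcedDecreasing_iff hρ hL h1] at h2
    obtain rfl : l = m := by
      by_contra hlm
      exact h2 (h1.boxed hρ hL hlm)
    rfl
  · exact fun _ _ => trivial

open Classical in
theorem numDiagDec_eq (hρ : Involutive ρ) (hL : Linked ρ) :
    numDiagDec ρ = #{i | Feas ρ i i ∧ Boxed ρ i} := by
  refine congrArg card (filter_congr fun i _ => ?_)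
  rw [not_infeasible_iff hρ hL]
  exact and_congr_right fun h => forcedDecreasing_iff hρ hL h

open Classical in
theorem numDec_eq (hρ : Involutive ρ) (hL : Linked ρ) : numDec ρ = #{i | i < partner ρ i} := by
  have hfeas : ∀ i, i < partner ρ i → Feas ρ i (partner ρ i) := fun i hi => by
    refine feas_partner ?_
    by_contra h
    rw [partner_of_not h] at hi
    exact hi.false
  refine card_bij' (fun c _ => c.2) (fun i _ => (partner ρ i, i)) ?_ ?_ ?_ ?_
  all_goals simp only [mem_filter, mem_univ, true_and, not_infeasible_iff hρ hL, Prod.forall]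
  · rintro m l ⟨h1, h2, -⟩
    rwa [h2.partner_eq hρ hL]
  · intro i hi
    exact ⟨hi, hfeas i hi, (forcedDecreasing_iff hρ hL (hfeas i hi)).2
      ((hfeas i hi).boxed hρ hL hi.ne)⟩
  · rintro m l ⟨h1, h2, -⟩
    rw [h2.partner_eq hρ hL]
  · exact fun _ _ => trivial

end Cells

/-- A linked involution is the kernel shape of an involution of any larger size. -/
theorem mem_kernelShapes_of_linked {s t : ℕ} {ρ : Equiv.Perm (Fin s)} (hρ : Involutive ρ)
    (hL : Linked ρ) (hs : 0 < s) (hst : s ≤ t) :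
    (⟨s, ρ⟩ : Σ s : ℕ, Equiv.Perm (Fin s)) ∈ kernelShapes t := by
  let l : Fin s := ⟨s - 1, by omega⟩
  have hl : (l : ℕ) + 1 = s := Nat.sub_add_cancel hs
  have hf : Feas ρ l l := feas_last hl
  have h1 := hf.partner_eq hρ hL
  -- The surplus letters go after the last letter of `ρ`, where the cell is always feasible.
  let g : Fin s → ℕ := fun i => if i = l then t - s else 0
  have hg : Compat ρ g := by
    constructor
    · intro i
      have : partner ρ i = l ↔ i = l := by
        constructor
        · intro h
          rw [← partner_partner hρ hL i, h, h1]
        · rintro rfl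
          exact h1
      simp only [g, this]
    · intro i hi
      obtain rfl : i = l := by
        by_contra hc
        exact hi (if_neg hc)
      exact ⟨_, hf⟩
  obtain ⟨L⟩ := Layout.exists_of_sum (n := t) g (by
    simp only [g, sum_add_distrib, sum_ite_eq', mem_univ, if_true]
    simp
    omega)
  obtain ⟨π, hπ, hb⟩ := exists_built hρ hL L hg (fun _ => Fin.revPerm)
    fun i => revPerm_mem_fillings i _
  exact (mem_kernelShapes _).2 ⟨π, hπ, L.base, hb.fits.isKernelEmb hρ hL hπ⟩

/-! ### Signs and numbers of occurrences of a built involution -/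

section Weights

variable {s n : ℕ} {ρ : Equiv.Perm (Fin s)} {π : Equiv.Perm (Fin n)} {g : Fin s → ℕ}

/-- The number of letters `j < π j`; for an involution this is the number of two-cycles. -/
def excCount (π : Equiv.Perm (Fin n)) : ℕ := #{j | j < π j}

theorem mem_occurrences_p21 {i : Fin 2 → Fin n} :
    i ∈ occurrences p21 π ↔ i 0 < i 1 ∧ π (i 1) < π (i 0) := by
  simp only [occurrences, mem_filter, mem_univ, true_and]
  constructor
  · rintro ⟨h1, h2⟩
    exact ⟨h1 0 1 (by decide), (h2 1 0).2 (by decide)⟩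
  · rintro ⟨h1, h2⟩
    constructor
    · intro a b hab
      fin_cases a <;> fin_cases b <;> simp at hab ⊢; order
    · intro a b
      fin_cases a <;> fin_cases b <;> simp [p21] <;> order

theorem fin_two_ext {α : Type*} {i j : Fin 2 → α} (h0 : i 0 = j 0) (h1 : i 1 = j 1) : i = j := by
  funext k
  fin_cases k
  exacts [h0, h1]

/-- The number of inversions of an involution has the parity of its number of two-cycles. -/
theorem neg_one_pow_occCount_p21 (hπ : Involutive π) :
    (-1 : ℚ) ^ occCount p21 π = (-1) ^ excCount π := by
  -- Reflection sends the inversion at `(i, j)` to the one at `(π j, π i)`; the inversions it fixes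
  -- are the two-cycles.
  have hfix : #{i ∈ occurrences p21 π | π (i 1) = i 0} = excCount π := by
    refine card_bij' (fun i _ => i 0) (fun j _ => ![j, π j]) ?_ ?_ ?_ ?_
    · intro i hi
      simp only [mem_filter, mem_occurrences_p21, mem_univ, true_and] at hi ⊢
      rw [← hi.2, hπ]
      rw [hi.2]
      exact hi.1.1
    · intro j hj
      simp only [mem_filter, mem_occurrences_p21, mem_univ, true_and] at hj ⊢
      simp [hπ j, hj]
    · intro i hi
      simp only [mem_filter] at hi
      refine fin_two_ext rfl ?_
      show π (i 0) = i 1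
      rw [← hi.2, hπ]
    · intro j hj
      rfl
  have hnon : Even #{i ∈ occurrences p21 π | ¬ π (i 1) = i 0} := by
    rw [← ZMod.natCast_eq_zero_iff_even, card_eq_sum_ones, Nat.cast_sum]
    refine sum_involution (fun i _ => ![π (i 1), π (i 0)]) ?_ ?_ ?_ ?_
    · intro i _
      decide
    · intro i hi _ h
      exact (mem_filter.1 hi).2 (congrFun h 0)
    · intro i hi
      simp only [mem_filter, mem_occurrences_p21] at hi ⊢
      refine ⟨⟨hi.1.2, ?_⟩, ?_⟩
      · simpa [hπ _] using hi.1.1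
      · intro h
        apply hi.2
        simpa [hπ _] using h.symm
    · intro i hi
      refine fin_two_ext ?_ ?_ <;> simp [hπ _]
  rw [occCount, ← card_filter_add_card_filter_not (fun i => π (i 1) = i 0), hfix, pow_add,
    hnon.neg_one_pow, mul_one]

theorem excCount_revPerm (k : ℕ) : excCount (Fin.revPerm : Equiv.Perm (Fin k)) = k / 2 := by
  have : #{j : Fin k | j < Fin.revPerm j} = #(range (k / 2)) := by
    refine card_bij (fun j _ => (j : ℕ)) ?_ (fun a _ b _ h => Fin.ext h) ?_
    · intro j hj
      simp only [mem_filter, mem_univ, true_and, Fin.revPerm_apply, Fin.lt_def, Fin.val_rev,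
        mem_range] at hj ⊢
      omega
    · intro j hj
      simp only [mem_range] at hj
      refine ⟨⟨j, by omega⟩, ?_, rfl⟩
      simp only [mem_filter, mem_univ, true_and, Fin.revPerm_apply, Fin.lt_def, Fin.val_rev]
      omega
  rw [excCount, this, card_range]

/-- All entries of a cell above the diagonal are excedances and none of a cell below it; on the
diagonal the filling decides. -/
theorem Built.excCount_eq {L : Layout g n}
    {σ : ∀ i, Equiv.Perm (Fin (g i))} (h : Built L ρ σ π) :
    excCount π = excCount ρ + ∑ i, (if i < partner ρ i then g i else
      if partner ρ i = i then excCount (σ i) else 0) := by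
  simp only [excCount, card_filter]
  rw [L.sum_eq, sum_add_distrib]
  congr 1
  · simp only [h.base, L.base_strictMono.lt_iff_lt]
  · refine sum_congr rfl fun i _ => ?_
    have hlt : ∀ t, L.inner i t < π (L.inner i t) ↔
        i < partner ρ i ∨ i = partner ρ i ∧ t < σ i t := fun t => by
      rw [h.inner, Layout.inner, Layout.inner, L.lt_iff]
      simp only [Fin.val_succ, Fin.val_cast, add_lt_add_iff_right, Fin.lt_def]
    simp only [hlt]
    rcases lt_trichotomy i (partner ρ i) with hi | hi | hi
    · simp [hi]
    · rw [if_neg hi.not_lt, if_pos hi.symm]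
      simp [← hi]
    · simp [hi.not_gt, hi.ne, hi.ne']

theorem Built.occCount_eq [DecidablePred (Free ρ)] (hρ : Involutive ρ) (hL : Linked ρ)
    (hπ : Involutive π) {L : Layout g n} {σ : ∀ i, Equiv.Perm (Fin (g i))} (h : Built L ρ σ π) :
    occCount p3412 π = occCount p3412 ρ + ∑ i with Free ρ i, occCount p3412 (σ i) := by
  have hfree : ∀ i (hi : Free ρ i) t, π (L.inner i t) = L.inner i (σ i t) := fun i hi t =>
    h.inner_of_free hρ hL hi t
  unfold occCount
  rw [← card_sigma, ← card_disjSum]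
  symm
  refine card_bij (fun x _ => Sum.elim (fun o k => L.base (o k)) (fun o k => L.inner o.1 (o.2 k)) x)
    ?_ ?_ ?_
  · rintro (o | ⟨i, o⟩) ho
    · rw [inl_mem_disjSum, mem_occurrences] at ho
      exact mem_occurrences.2 ((Occ.of_copy L.base_strictMono h.base).2 ho)
    · rw [inr_mem_disjSum, mem_sigma, mem_occurrences, mem_filter] at ho
      obtain ⟨⟨-, hi⟩, ho⟩ := ho
      refine mem_occurrences.2 ?_
      simpa only [Occ, Sum.elim_inr, hfree i hi, L.inner_lt] using ho
  · rintro (o | ⟨i, o⟩) ho (o' | ⟨i', o'⟩) ho' heq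
    · congr 1
      funext k
      exact L.base_strictMono.injective (congrFun heq k)
    · exact absurd ⟨_, congrFun heq 0⟩ (L.inner_notMem i' (o' 0))
    · exact absurd ⟨_, (congrFun heq 0).symm⟩ (L.inner_notMem i (o 0))
    · obtain rfl : i = i' := (L.inner_inj.1 (congrFun heq 0)).1
      congr 2
      funext k
      exact Fin.ext (L.inner_inj.1 (congrFun heq k)).2
  · intro o ho
    have ho' := mem_occurrences.1 ho
    have hall : ∀ {p : Fin n → Prop}, (∀ x ∈ [o 0, o 1, o 2, o 3], p x) → ∀ k, p (o k) := by
      intro p hp k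
      fin_cases k <;> exact hp _ (by simp)
    rcases h.fits.occ hρ hL hπ ho' with hK | ⟨i, h1, h2, hB⟩
    · choose f hf using hall hK
      refine ⟨.inl f, ?_, funext hf⟩
      rw [inl_mem_disjSum, mem_occurrences]
      rw [← Occ.of_copy L.base_strictMono h.base]
      simpa only [hf] using ho'
    · have hi : Free ρ i := ⟨h1, h2⟩
      choose f hf using fun k => L.eq_inner (hall hB k).1 (hall hB k).2
      refine ⟨.inr ⟨i, f⟩, ?_, funext hf⟩
      rw [inr_mem_disjSum, mem_sigma, mem_occurrences, mem_filter]
      refine ⟨⟨mem_univ _, hi⟩, ?_⟩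
      have : Occ π (L.inner i (f 0)) (L.inner i (f 1)) (L.inner i (f 2)) (L.inner i (f 3)) := by
        simpa only [hf] using ho'
      simpa only [Occ, hfree i hi, L.inner_lt] using this

end Weights

/-! ### The size of a linked involution -/

section Size

variable {s : ℕ} {ρ : Equiv.Perm (Fin s)}

open Classical in
/-- An edge between letters of the occurrence `o`; together with the edges joining `k` and `ρ k`
these edges connect the letters of every occurrence. -/
noncomputable def occEdge (ρ : Equiv.Perm (Fin s)) (o : Fin 4 → Fin s) : Sym2 (Fin s) :=
  -- A symmetric occurrence joins its two two-cycles. The last case supplies the second edge needed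
  -- by the mirror image when that has a crossing only in its lower part.
  if ρ (o 0) = o 2 ∧ ρ (o 1) = o 3 then s(o 0, o 1)
  else if ρ (o 3) < o 2 then s(o 2, o 0) else s(o 0, o 3)

noncomputable def linkEdges (ρ : Equiv.Perm (Fin s)) : Finset (Sym2 (Fin s)) :=
  (occurrences p3412 ρ).image (occEdge ρ) ∪ ({k | k < ρ k} : Finset (Fin s)).image fun k => s(k, ρ k)

theorem two_mul_excCount_le (hρ : Involutive ρ) : 2 * excCount ρ ≤ s := by
  have h : excCount ρ = #{k | ρ k < k} := by
    refine card_bij' (fun k _ => ρ k) (fun k _ => ρ k) ?_ ?_ ?_ ?_ <;> simp [hρ _]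
  have hd : Disjoint ({k | k < ρ k} : Finset (Fin s)) ({k | ρ k < k} : Finset (Fin s)) := by
    rw [disjoint_filter]
    exact fun k _ h1 h2 => (h1.trans h2).false
  have := card_union_of_disjoint hd
  have hle := card_le_univ (({k | k < ρ k} : Finset (Fin s)) ∪ ({k | ρ k < k} : Finset (Fin s)))
  rw [Fintype.card_fin] at hle
  unfold excCount at *
  omega

/-- A linked involution with `c` occurrences of `3412` has at most `2 * c + 2` letters. -/
theorem Linked.card_le (hρ : Involutive ρ) (hL : Linked ρ) (hs : 0 < s) :
    s ≤ 2 * occCount p3412 ρ + 2 := by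
  classical
  let G := SimpleGraph.fromEdgeSet (linkEdges ρ : Set (Sym2 (Fin s)))
  have hedge : ∀ {x y}, s(x, y) ∈ linkEdges ρ → G.Reachable x y := fun {x y} h => by
    by_cases hxy : x = y
    · rw [hxy]
    · exact SimpleGraph.Adj.reachable ((SimpleGraph.fromEdgeSet_adj _).2 ⟨h, hxy⟩)
  have hinv : ∀ k, G.Reachable k (ρ k) := fun k => by
    rcases lt_trichotomy k (ρ k) with h | h | h
    · exact hedge (mem_union_right _ (mem_image.2 ⟨k, by simpa using h, rfl⟩))
    · rw [← h]
    · refine (hedge (mem_union_right _ (mem_image.2 ⟨ρ k, by simpa [hρ k] using h, ?_⟩))).symm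
      rw [hρ k]
  have hocc : ∀ {a b c d}, Occ ρ a b c d → ∀ {x y}, occEdge ρ ![a, b, c, d] = s(x, y) →
      G.Reachable x y := fun {a b c d} ho {x y} h =>
    hedge (mem_union_left _ (mem_image.2 ⟨_, mem_occurrences_cons.2 ho, h⟩))
  have hcross : ∀ {u v}, Crossing ρ u v → G.Reachable u v := fun {u v} h =>
    hocc (h.occ hρ) (by simp [occEdge])
  have hlow : ∀ {a b c d}, Occ ρ a b c d → ρ d < c →
      G.Reachable a c ∧ G.Reachable b c ∧ G.Reachable d c := by
    intro a b c d ho hdc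
    have hcd : G.Reachable d c :=
      ((hinv d).trans (hcross (ho.crossing_low hρ hdc)).symm).trans (hinv c).symm
    by_cases hsym : ρ a = c ∧ ρ b = d
    · have h1 : G.Reachable a c := hsym.1 ▸ hinv a
      have h2 : G.Reachable b d := hsym.2 ▸ hinv b
      exact ⟨h1, h2.trans hcd, hcd⟩
    · have hca : G.Reachable c a := hocc ho (by simp [occEdge, hsym, hdc])
      refine ⟨hca.symm, ?_, hcd⟩
      by_cases hba : b < ρ a
      · obtain ⟨h1, h2, h3, h4, h5, h6⟩ := ho
        exact (hcross ⟨h1, hba, h6⟩).symm.trans hca.symm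
      -- Now `a` and `b` do not cross, and `b` is reached by the edge from `ρ c` to `ρ b` of the
      -- mirror occurrence.
      · have hsym' : ¬ (ρ (ρ c) = ρ a ∧ ρ (ρ d) = ρ b) := by
          rw [hρ, hρ]
          exact fun h => hsym ⟨h.1.symm, h.2.symm⟩
        have hba' : ¬ ρ (ρ b) < ρ a := by rwa [hρ]
        have : G.Reachable (ρ c) (ρ b) :=
          hocc (ho.inv hρ) ((if_neg hsym').trans (if_neg hba'))
        exact ((hinv b).trans this.symm).trans (hinv c).symm
  let z : Fin s := ⟨0, hs⟩
  have hconn : ∀ x, G.Reachable z x := by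
    refine hL {x | G.Reachable z x} ?_ ?_ ?_
    · intro k hk
      rw [show k = z from Fin.ext hk]
      exact SimpleGraph.Reachable.refl _
    · exact fun x hx => SimpleGraph.Reachable.trans hx (hinv x)
    · refine occClosed_of_low hρ (fun x hx => SimpleGraph.Reachable.trans hx (hinv x)) ?_
      intro a b c d ho hdc hm
      obtain ⟨h1, h2, h3⟩ := hlow ho hdc
      have hc : G.Reachable z c := by
        rcases hm with h | h | h | h
        exacts [h.trans h1, h.trans h2, h, h.trans h3]
      exact ⟨hc.trans h1.symm, hc.trans h2.symm, hc, hc.trans h3.symm⟩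
  have hG : G.Connected := by
    have : Nonempty (Fin s) := ⟨z⟩
    exact ⟨fun x y => (hconn x).symm.trans (hconn y)⟩
  -- Connectedness gives `s ≤ c + x + 1` for `c` occurrences and `x ≤ s / 2` two-cycles.
  have h1 := hG.card_vert_le_card_edgeSet_add_one
  have h2 : Nat.card G.edgeSet ≤ #(linkEdges ρ) := by
    rw [SimpleGraph.edgeSet_fromEdgeSet]
    have := Set.ncard_le_ncard (s := ((linkEdges ρ : Set (Sym2 (Fin s))) \ {e | e.IsDiag}))
      Set.sdiff_subset (linkEdges ρ).finite_toSet
    rw [Set.ncard_coe_finset] at this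
    exact this
  have h3 : #(linkEdges ρ) ≤ occCount p3412 ρ + excCount ρ :=
    (card_union_le _ _).trans (add_le_add card_image_le card_image_le)
  have h4 := two_mul_excCount_le hρ
  rw [Nat.card_eq_fintype_card, Fintype.card_fin] at h1
  omega

end Size

theorem sum_eq_sum_of_existsUnique {α β M : Type*} [AddCommMonoid M] {A : Finset α} {S : Finset β}
    {R : α → β → Prop} [∀ a b, Decidable (R a b)] (h : ∀ a ∈ A, ∃! b, b ∈ S ∧ R a b) (f : α → M) :
    ∑ a ∈ A, f a = ∑ b ∈ S, ∑ a ∈ A with R a b, f a := by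
  classical
  rw [sum_comm' (t' := A) (s' := fun a => S.filter (R a))
    (fun b a => by simp only [mem_filter]; tauto)]
  refine sum_congr rfl fun a ha => ?_
  obtain ⟨b, hb, hu⟩ := h a ha
  have : S.filter (R a) = {b} := by
    ext b'
    rw [mem_filter, mem_singleton]
    exact ⟨hu b', by rintro rfl; exact hb⟩
  rw [this, sum_singleton]

/-! ### Power series of the decreasing cells -/

section Series

/-- Two mirrored blocks with `k` letters in all form `k / 2` two-cycles, and `k` is even. -/
theorem coeff_inv_one_add_X_sq (k : ℕ) :
    coeff k ((1 + X ^ 2 : PowerSeries ℚ)⁻¹) = if Even k then (-1) ^ (k / 2) else 0 := by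
  have : PowerSeries.mk (fun k => if Even k then (-1 : ℚ) ^ (k / 2) else 0) =
      (1 + X ^ 2 : PowerSeries ℚ)⁻¹ := by
    rw [PowerSeries.eq_inv_iff_mul_eq_one (by simp)]
    ext k
    rw [mul_add, mul_one, map_add, coeff_mul_X_pow', coeff_mk, coeff_one]
    rcases k with _ | _ | k
    · simp
    · simp
    · have : (k + 1 + 1) / 2 = k / 2 + 1 := by omega
      simp only [coeff_mk, this, show k + 1 + 1 - 2 = k from rfl, Nat.even_add_one, not_not]
      by_cases hk : Even k <;> simp [hk, pow_succ]
  rw [← this, coeff_mk]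

/-- A decreasing block of `k` letters on the diagonal has `k / 2` two-cycles, rounded down. -/
theorem coeff_one_add_X_mul_inv (k : ℕ) :
    coeff k ((1 + X) * (1 + X ^ 2 : PowerSeries ℚ)⁻¹) = (-1) ^ (k / 2) := by
  rw [add_mul, one_mul, map_add, coeff_inv_one_add_X_sq]
  rcases k with _ | k
  · simp
  · rw [coeff_succ_X_mul, coeff_inv_one_add_X_sq]
    by_cases hk : Even k
    · have : (k + 1) / 2 = k / 2 := by obtain ⟨m, rfl⟩ := hk; omega
      simp [hk, Nat.even_add_one, this]
    · simp [hk, Nat.even_add_one]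

theorem coeff_prod_eq_sum_piAntidiag {ι R : Type*} [DecidableEq ι] [CommSemiring R] (S : Finset ι)
    (d : ℕ) (f : ι → PowerSeries R) :
    coeff d (∏ i ∈ S, f i) = ∑ t ∈ piAntidiag S d, ∏ i ∈ S, coeff (t i) (f i) := by
  rw [PowerSeries.coeff_prod]
  refine sum_bij (fun l _ => ⇑l) ?_ (fun _ _ _ _ h => DFunLike.coe_injective h) ?_ fun _ _ => rfl
  · intro l hl
    rw [mem_finsuppAntidiag] at hl
    exact mem_piAntidiag.2 ⟨hl.1, fun i hi => hl.2 (Finsupp.mem_support_iff.2 hi)⟩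
  · intro t ht
    rw [mem_piAntidiag] at ht
    refine ⟨Finsupp.onFinset S t ht.2, mem_finsuppAntidiag.2 ⟨ht.1, ?_⟩, rfl⟩
    exact Finsupp.support_onFinset_subset

/-- Only the size of `S` matters, so the set of free columns may be replaced by `Fin (numFree ρ)`.
-/
theorem sum_piAntidiag_prod {ι R : Type*} [DecidableEq ι] [CommSemiring R] (S : Finset ι) (d : ℕ)
    (N : ℕ → R) :
    ∑ t ∈ piAntidiag S d, ∏ i ∈ S, N (t i) = coeff d (PowerSeries.mk N ^ #S) := by
  rw [← prod_const, coeff_prod_eq_sum_piAntidiag]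
  simp only [coeff_mk]

end Series

/-! ### Summing over fillings and block sizes -/

section Fixed

variable {s n : ℕ} {ρ : Equiv.Perm (Fin s)} {π : Equiv.Perm (Fin n)} {g : Fin s → ℕ}

/-- The number of two-cycles that the `k` letters following the letter `i`, permuted by `σ` or
exchanged with a later block, contribute. -/
noncomputable def fillExc (ρ : Equiv.Perm (Fin s)) (i : Fin s) {k : ℕ} (σ : Equiv.Perm (Fin k)) :
    ℕ :=
  if i < partner ρ i then k else if partner ρ i = i then excCount σ else 0

open Classical in
/-- The signed number of fillings of size `k` of the feasible cell in the column after `i`; they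
contain `3412` exactly `t` times if the cell is free. -/
noncomputable def fillCount (ρ : Equiv.Perm (Fin s)) (i : Fin s) (t k : ℕ) : ℚ :=
  ∑ σ ∈ fillings ρ i k with (Free ρ i → occCount p3412 σ = t), (-1) ^ fillExc ρ i σ

open Classical in
theorem sum_fits (hρ : Involutive ρ) (hL : Linked ρ) (L : Layout g n) (hg : Compat ρ g) (r : ℕ) :
    ∑ π ∈ involutions r n with Fits ρ π L.base, (-1 : ℚ) ^ occCount p21 π =
      (-1) ^ excCount ρ * ∑ σ ∈ Fintype.piFinset (fun i => fillings ρ i (g i)) with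
        occCount p3412 ρ + ∑ i with Free ρ i, occCount p3412 (σ i) = r,
          ∏ i, (-1) ^ fillExc ρ i (σ i) := by
  rw [mul_sum]
  symm
  have hex : ∀ σ : ∀ i, Equiv.Perm (Fin (g i)), σ ∈ Fintype.piFinset (fun i => fillings ρ i (g i)) →
      ∃ π : Equiv.Perm (Fin n), Involutive π ∧ Built L ρ σ π := fun σ hσ =>
    exists_built hρ hL L hg σ (Fintype.mem_piFinset.1 hσ)
  choose F hF using hex
  refine sum_bij (fun σ hσ => F σ (mem_filter.1 hσ).1) ?_ ?_ ?_ ?_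
  · intro σ hσ
    obtain ⟨h1, h2⟩ := hF σ (mem_filter.1 hσ).1
    rw [mem_filter, involutions, mem_filter]
    refine ⟨⟨mem_univ _, h1, ?_⟩, h2.fits⟩
    rw [h2.occCount_eq hρ hL h1]
    exact (mem_filter.1 hσ).2
  · intro σ hσ σ' hσ' heq
    have h1 := (hF σ (mem_filter.1 hσ).1).2
    have h2 := (hF σ' (mem_filter.1 hσ').1).2
    rw [← heq] at h2
    exact h1.filling_unique h2
  · intro π hπ
    rw [mem_filter, involutions, mem_filter] at hπ
    obtain ⟨⟨-, h1, h2⟩, h3⟩ := hπ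
    obtain ⟨σ, hσ⟩ := h3.built hρ hL h1
    have hm : σ ∈ Fintype.piFinset (fun i => fillings ρ i (g i)) := Fintype.mem_piFinset.2 hσ.mem
    refine ⟨σ, mem_filter.2 ⟨hm, ?_⟩, (hF σ hm).2.unique hσ⟩
    rw [← hσ.occCount_eq hρ hL h1]
    exact h2
  · intro σ hσ
    obtain ⟨h1, h2⟩ := hF σ (mem_filter.1 hσ).1
    rw [neg_one_pow_occCount_p21 h1, h2.excCount_eq, pow_add, prod_pow_eq_pow_sum]
    rfl

-- Sorting the fillings by how many occurrences each free cell receives turns the sum into products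
-- over columns.
open Classical in
theorem sum_fillings {r : ℕ} (hc : occCount p3412 ρ ≤ r) (g : Fin s → ℕ) :
    ∑ σ ∈ Fintype.piFinset (fun i => fillings ρ i (g i)) with
        occCount p3412 ρ + ∑ i with Free ρ i, occCount p3412 (σ i) = r,
          ∏ i, (-1 : ℚ) ^ fillExc ρ i (σ i) =
      ∑ t ∈ piAntidiag ({i | Free ρ i} : Finset (Fin s)) (r - occCount p3412 ρ),
        ∏ i, fillCount ρ i (t i) (g i) := by
  rw [sum_eq_sum_of_existsUnique (S := piAntidiag ({i | Free ρ i} : Finset (Fin s))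
    (r - occCount p3412 ρ)) (R := fun σ t => ∀ i, Free ρ i → occCount p3412 (σ i) = t i)]
  · refine sum_congr rfl fun t ht => ?_
    simp only [fillCount]
    rw [prod_univ_sum]
    refine sum_congr ?_ fun _ _ => rfl
    ext σ
    simp only [mem_filter, Fintype.mem_piFinset]
    have hsum := (mem_piAntidiag.1 ht).1
    constructor
    · rintro ⟨⟨h1, -⟩, h2⟩ i
      exact ⟨h1 i, h2 i⟩
    · intro h
      refine ⟨⟨fun i => (h i).1, ?_⟩, fun i => (h i).2⟩
      rw [sum_congr rfl fun i hi => (h i).2 (mem_filter.1 hi).2, hsum]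
      omega
  · intro σ hσ
    have hsum := (mem_filter.1 hσ).2
    refine ⟨fun i => if Free ρ i then occCount p3412 (σ i) else 0, ⟨mem_piAntidiag.2 ⟨?_, ?_⟩, ?_⟩, ?_⟩
    · rw [sum_congr rfl fun i hi => if_pos (mem_filter.1 hi).2]
      omega
    · intro i hi
      rw [mem_filter]
      by_contra h
      exact hi (if_neg fun h' => h ⟨mem_univ _, h'⟩)
    · exact fun i hi => (if_pos hi).symm
    · rintro t ⟨ht, hR⟩
      funext i
      split_ifs with hi
      · exact (hR i hi).symm
      · by_contra h
        exact hi (mem_filter.1 ((mem_piAntidiag.1 ht).2 i h)).2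

open Classical in
/-- The signed generating function of the fillings of the feasible cell in the column after `i`; a
pair of cells exchanged by the involution is attributed to the one above the diagonal. -/
noncomputable def cellGF (ρ : Equiv.Perm (Fin s)) (t : ℕ) (i : Fin s) : PowerSeries ℚ :=
  if Free ρ i then signedGF t
  else if i < partner ρ i then (1 + X ^ 2)⁻¹
  else if Feas ρ i i ∧ Boxed ρ i then (1 + X) * (1 + X ^ 2)⁻¹
  else 1

/-- The number of letters in the cells whose fillings `cellGF` counts. -/
noncomputable def cellSize (ρ : Equiv.Perm (Fin s)) (g : Fin s → ℕ) (i : Fin s) : ℕ :=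
  if i < partner ρ i then 2 * g i else if partner ρ i = i then g i else 0

theorem fillCount_eq_coeff (hρ : Involutive ρ) (hL : Linked ρ) (hg : Compat ρ g) (t : ℕ)
    (i : Fin s) : fillCount ρ i t (g i) = coeff (cellSize ρ g i) (cellGF ρ t i) := by
  classical
  by_cases hi : Free ρ i
  · have hp := hi.partner_eq hρ hL
    have : ∀ σ : Equiv.Perm (Fin (g i)), fillExc ρ i σ = excCount σ := fun σ => by
      simp [fillExc, hp]
    simp only [fillCount, cellSize, cellGF, if_pos hi, hp, lt_irrefl, if_false, coeff_signedGF,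
      this, if_true]
    refine sum_congr ?_ fun σ hσ => ?_
    · ext σ
      rw [mem_filter, mem_fillings_of_free hi, involutions, mem_filter]
      simp [hi]
    · rw [involutions, mem_filter] at hσ
      rw [neg_one_pow_occCount_p21 hσ.2.1]
  · have hfill : fillCount ρ i t (g i) =
        (-1) ^ fillExc ρ i (Fin.revPerm : Equiv.Perm (Fin (g i))) := by
      simp [fillCount, fillings, hi]
    rw [hfill]
    rcases lt_trichotomy i (partner ρ i) with hp | hp | hp
    · simp only [fillExc, cellSize, cellGF, if_neg hi, if_pos hp, coeff_inv_one_add_X_sq]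
      simp
    · simp only [fillExc, cellSize, cellGF, if_neg hi, if_neg hp.not_lt, if_pos hp.symm,
        excCount_revPerm]
      split_ifs with hf
      · rw [coeff_one_add_X_mul_inv]
      · have : g i = 0 := by
          by_contra h0
          have hfe := feas_partner (hg.feas i h0)
          have hb := boxed_of_not_free hρ hL hfe hi
          rw [← hp] at hfe
          exact hf ⟨hfe, hb⟩
        simp [this]
    · have hf : ¬ (Feas ρ i i ∧ Boxed ρ i) := fun h => hp.ne (h.1.partner_eq hρ hL)
      simp [fillExc, cellSize, cellGF, hi, hp.not_gt, hp.ne, hf]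

theorem sum_cellSize (hρ : Involutive ρ) (hL : Linked ρ) (hg : Compat ρ g) :
    ∑ i, cellSize ρ g i = ∑ i, g i := by
  have hpp := partner_partner hρ hL
  let τ : Equiv.Perm (Fin s) := Involutive.toPerm (partner ρ) hpp
  have h1 : ∑ i, (if i < partner ρ i then g i else 0) =
      ∑ i, (if partner ρ i < i then g i else 0) := by
    rw [← Equiv.sum_comp τ]
    refine sum_congr rfl fun i _ => ?_
    show (if partner ρ i < partner ρ (partner ρ i) then g (partner ρ i) else 0) = _
    rw [hpp, hg.partner]
  have h2 : ∀ i, cellSize ρ g i = (if i < partner ρ i then g i else 0) +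
      ((if i < partner ρ i then g i else 0) + (if partner ρ i = i then g i else 0)) := fun i => by
    unfold cellSize
    rcases lt_trichotomy i (partner ρ i) with h | h | h
    · simp only [if_pos h, if_neg h.ne']; omega
    · simp [← h]
    · simp [h.not_gt, h.ne]
  have h3 : ∀ i, g i = (if partner ρ i < i then g i else 0) +
      ((if i < partner ρ i then g i else 0) + (if partner ρ i = i then g i else 0)) := fun i => by
    rcases lt_trichotomy i (partner ρ i) with h | h | h
    · simp [h, h.not_gt, h.ne']
    · simp [← h]
    · simp [h, h.not_gt, h.ne]
  rw [sum_congr rfl fun i _ => h2 i, sum_congr rfl fun i _ => h3 i]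
  simp only [sum_add_distrib, h1]

-- `cellSize` credits both blocks of a pair to the cell above the diagonal and is injective on
-- compatible sizes. Exponents outside its image have a zero coefficient: they are odd at such a
-- cell, or nonzero at its mirror image or in a column without a feasible cell.
open Classical in
theorem sum_compat (hρ : Involutive ρ) (hL : Linked ρ) (d : ℕ) (t : Fin s → ℕ) :
    ∑ g ∈ piAntidiag univ d with Compat ρ g, ∏ i, fillCount ρ i (t i) (g i) =
      coeff d (∏ i, cellGF ρ (t i) i) := by
  rw [coeff_prod_eq_sum_piAntidiag]
  refine sum_of_injOn (cellSize ρ) ?_ ?_ ?_ ?_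
  · intro g hg g' hg' heq
    have hg := (mem_filter.1 hg).2
    have hg' := (mem_filter.1 hg').2
    have key : ∀ i, i ≤ partner ρ i → g i = g' i := fun i hi => by
      have := congrFun heq i
      unfold cellSize at this
      rcases hi.lt_or_eq with h | h
      · simpa [h] using this
      · simpa [← h] using this
    funext i
    rcases le_total i (partner ρ i) with h | h
    · exact key i h
    · rw [← hg.partner, ← hg'.partner]
      exact key _ (by rwa [partner_partner hρ hL])
  · intro g hg
    obtain ⟨h1, h2⟩ := mem_filter.1 hg
    refine mem_piAntidiag.2 ⟨?_, fun _ _ => mem_univ _⟩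
    rw [sum_cellSize hρ hL h2]
    exact (mem_piAntidiag.1 h1).1
  · intro l hl hne
    by_contra hprod
    apply hne
    have hnz : ∀ i, coeff (l i) (cellGF ρ (t i) i) ≠ 0 := fun i =>
      (prod_ne_zero_iff.1 hprod) i (mem_univ i)
    have hfree : ∀ i, Free ρ i → partner ρ i = i := fun i hi => hi.partner_eq hρ hL
    have hlt : ∀ i, i < partner ρ i → Even (l i) := fun i hi => by
      have := hnz i
      rw [cellGF, if_neg fun h => hi.ne' (hfree i h), if_pos hi, coeff_inv_one_add_X_sq] at this
      by_contra h
      exact this (if_neg h)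
    have hgt : ∀ i, partner ρ i < i → l i = 0 := fun i hi => by
      have := hnz i
      rw [cellGF, if_neg fun h => hi.ne (hfree i h), if_neg hi.not_gt,
        if_neg fun h => hi.ne (h.1.partner_eq hρ hL), coeff_one] at this
      by_contra h
      exact this (if_neg h)
    have heq : ∀ i, partner ρ i = i → ¬ Feas ρ i i → l i = 0 := fun i hi hf => by
      have := hnz i
      rw [cellGF, if_neg fun h => hf h.1, if_neg (by rw [hi]; exact lt_irrefl _),
        if_neg fun h => hf h.1, coeff_one] at this
      by_contra h
      exact this (if_neg h)
    let g : Fin s → ℕ := fun i => if i < partner ρ i then l i / 2 else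
      if partner ρ i = i then l i else l (partner ρ i) / 2
    have hg : Compat ρ g := by
      constructor
      · intro i
        simp only [g, partner_partner hρ hL]
        rcases lt_trichotomy i (partner ρ i) with h | h | h
        · simp [h, h.not_gt, h.ne]
        · simp [← h]
        · simp [h, h.not_gt, h.ne]
      · intro i hi
        by_contra hno
        have hp := partner_of_not hno
        refine hi ?_
        simp only [g, hp, lt_irrefl, if_false, if_true]
        exact heq i hp fun h => hno ⟨_, h⟩
    have hsize : cellSize ρ g = l := by
      funext i
      simp only [cellSize, g]
      rcases lt_trichotomy i (partner ρ i) with h | h | h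
      · simp only [if_pos h]
        exact Nat.two_mul_div_two_of_even (hlt i h)
      · simp [← h]
      · simp [h.not_gt, h.ne, hgt i h]
    refine ⟨g, ?_, hsize⟩
    refine mem_coe.2 (mem_filter.2 ⟨mem_piAntidiag.2 ⟨?_, fun _ _ => mem_univ _⟩, hg⟩)
    rw [← sum_cellSize hρ hL hg, hsize]
    exact (mem_piAntidiag.1 hl).1
  · intro g hg
    exact prod_congr rfl fun i _ => fillCount_eq_coeff hρ hL (mem_filter.1 hg).2 (t i) i

end Fixed

theorem occCount_le_of_hasKernelShape {s n : ℕ} {ρ : Equiv.Perm (Fin s)} {π : Equiv.Perm (Fin n)}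
    (hπ : Involutive π) (h : HasKernelShape π ρ) : occCount p3412 ρ ≤ occCount p3412 π := by
  obtain ⟨e, he⟩ := h
  refine card_le_card_of_injOn (fun o k => e (o k)) (fun o ho => ?_) fun o _ o' _ h => ?_
  · exact mem_occurrences.2 ((Occ.of_copy he.1 (he.map hπ)).2 (mem_occurrences.1 ho))
  · exact funext fun k => he.1.injective (congrFun h k)

/-! ### The contribution of one kernel shape -/

section Shape

variable {s n : ℕ} {ρ : Equiv.Perm (Fin s)}

theorem inv_pow_one_add_X_sq (k : ℕ) :
    ((1 + X ^ 2 : PowerSeries ℚ) ^ k)⁻¹ = ((1 + X ^ 2 : PowerSeries ℚ)⁻¹) ^ k := by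
  symm
  rw [PowerSeries.eq_inv_iff_mul_eq_one (by simp), ← mul_pow, PowerSeries.inv_mul_cancel _ (by simp),
    one_pow]

open Classical in
theorem prod_cellGF (hρ : Involutive ρ) (hL : Linked ρ) (t : Fin s → ℕ) :
    ∏ i, cellGF ρ (t i) i = (1 + X) ^ numDiagDec ρ *
      ((1 + X ^ 2 : PowerSeries ℚ) ^ (numDec ρ + numDiagDec ρ))⁻¹ *
        ∏ i with Free ρ i, signedGF (t i) := by
  have h : ∀ i, cellGF ρ (t i) i = (if Free ρ i then signedGF (t i) else 1) *
      ((if i < partner ρ i then (1 + X ^ 2)⁻¹ else 1) *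
        (if Feas ρ i i ∧ Boxed ρ i then (1 + X) * (1 + X ^ 2)⁻¹ else 1)) := fun i => by
    unfold cellGF
    by_cases h1 : Free ρ i
    · have hp := h1.partner_eq hρ hL
      have h3 : ¬ (Feas ρ i i ∧ Boxed ρ i) := fun h => h1.2 h.2
      simp [h1, hp, h3]
    · by_cases h2 : i < partner ρ i
      · have h3 : ¬ (Feas ρ i i ∧ Boxed ρ i) := fun h => h2.ne' (h.1.partner_eq hρ hL)
        simp [h1, h2, h3]
      · simp [h1, h2]
  rw [prod_congr rfl fun i _ => h i, prod_mul_distrib, prod_mul_distrib, ← prod_filter,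
    ← prod_filter, ← prod_filter, prod_const, prod_const, ← numDiagDec_eq hρ hL,
    ← numDec_eq hρ hL, inv_pow_one_add_X_sq, mul_pow, pow_add]
  ring

open Classical in
theorem existsUnique_sizes (hρ : Involutive ρ) (hL : Linked ρ) {d : ℕ} (hn : n = d + s)
    {π : Equiv.Perm (Fin n)} (hπ : Involutive π) (h : HasKernelShape π ρ) :
    ∃! g, g ∈ ({g ∈ piAntidiag univ d | Compat ρ g} : Finset (Fin s → ℕ)) ∧
      ∃ L : Layout g n, Fits ρ π L.base := by
  obtain ⟨e, he⟩ := h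
  have hfit := he.fits hπ
  obtain ⟨g, L, rfl⟩ := Layout.exists_of_strictMono he.1 fun j hj => hfit.zero_mem hj
  obtain ⟨σ, hσ⟩ := hfit.built hρ hL hπ
  have hsum := L.sum_card
  simp only [sum_add_distrib, sum_const, card_univ, Fintype.card_fin, smul_eq_mul, mul_one] at hsum
  have hd : univ.sum g = d := by
    show ∑ i, g i = d
    omega
  refine ⟨g, ⟨mem_filter.2 ⟨mem_piAntidiag.2 ⟨hd, fun _ _ => mem_univ _⟩, hσ.compat⟩, L, hfit⟩,
    ?_⟩
  rintro g' ⟨-, L', hfit'⟩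
  have he' := hfit'.isKernelEmb hρ hL hπ
  exact L'.base_injective L ((he'.1.range_inj he.1).1 (he'.2.1.trans he.2.1.symm))

open Classical in
/-- The signed number of involutions with a given kernel shape. -/
theorem sum_hasKernelShape (hρ : Involutive ρ) (hL : Linked ρ) (r n : ℕ) :
    ∑ π ∈ involutions r n with HasKernelShape π ρ, (-1 : ℚ) ^ occCount p21 π =
      coeff n ((-1) ^ occCount p21 ρ * X ^ s * (1 + X) ^ numDiagDec ρ *
        ((1 + X ^ 2 : PowerSeries ℚ) ^ (numDec ρ + numDiagDec ρ))⁻¹ *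
        (if occCount p3412 ρ ≤ r then
          ∑ t ∈ piAntidiag (univ : Finset (Fin (numFree ρ))) (r - occCount p3412 ρ),
            ∏ j, signedGF (t j)
        else 0)) := by
  have hsign : ((-1 : PowerSeries ℚ)) ^ occCount p21 ρ = C ((-1 : ℚ) ^ occCount p21 ρ) := by
    simp
  have hre : ∀ A B F : PowerSeries ℚ, C ((-1 : ℚ) ^ occCount p21 ρ) * X ^ s * A * B * F =
      C ((-1 : ℚ) ^ occCount p21 ρ) * (X ^ s * (A * B * F)) := fun A B F => by ring
  rw [hsign, hre, coeff_C_mul, coeff_X_pow_mul', neg_one_pow_occCount_p21 hρ]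
  split_ifs with hsn hc
  · obtain ⟨d, rfl⟩ : ∃ d, n = d + s := ⟨n - s, by omega⟩
    have hF : ∑ t ∈ piAntidiag (univ : Finset (Fin (numFree ρ))) (r - occCount p3412 ρ),
        ∏ j, signedGF (t j) = ∑ t ∈ piAntidiag ({i | Free ρ i} : Finset (Fin s))
          (r - occCount p3412 ρ), ∏ i with Free ρ i, signedGF (t i) := by
      rw [sum_piAntidiag_prod, sum_piAntidiag_prod, card_univ, Fintype.card_fin, numFree_eq hρ hL]
    rw [hF, mul_sum, Nat.add_sub_cancel]
    simp only [← prod_cellGF hρ hL]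
    rw [map_sum]
    simp only [← sum_compat hρ hL]
    -- The involutions are sorted by their block sizes, which the kernel positions determine.
    rw [sum_comm, mul_sum, sum_eq_sum_of_existsUnique
      (S := ({g ∈ piAntidiag univ d | Compat ρ g} : Finset (Fin s → ℕ)))
      (R := fun π g => ∃ L : Layout g (d + s), Fits ρ π L.base)
      (fun π hπ => existsUnique_sizes hρ hL rfl (mem_filter.1 (mem_filter.1 hπ).1).2.1
        (mem_filter.1 hπ).2)]
    refine sum_congr rfl fun g hg => ?_
    obtain ⟨hg, hcomp⟩ := mem_filter.1 hg
    have hsum : ∑ i, (g i + 1) = d + s := by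
      rw [sum_add_distrib, (mem_piAntidiag.1 hg).1]
      simp
    obtain ⟨L⟩ := Layout.exists_of_sum g hsum
    rw [← sum_fillings hc, ← sum_fits hρ hL L hcomp]
    refine sum_congr ?_ fun _ _ => rfl
    ext π
    simp only [mem_filter]
    constructor
    · rintro ⟨⟨h1, -⟩, L', h2⟩
      have hb : L'.base = L.base := funext fun i => congrFun (congrFun (L'.unique L) i) 0
      exact ⟨h1, hb ▸ h2⟩
    · rintro ⟨h1, h2⟩
      exact ⟨⟨h1, _, h2.isKernelEmb hρ hL (mem_filter.1 h1).2.1⟩, L, h2⟩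
  · simp only [mul_zero, map_zero]
    refine sum_eq_zero fun π hπ => absurd ?_ hc
    obtain ⟨h1, h⟩ := mem_filter.1 hπ
    obtain ⟨-, hinv, rfl⟩ := mem_filter.1 h1
    exact occCount_le_of_hasKernelShape hinv h
  · rw [mul_zero]
    refine sum_eq_zero fun π hπ => absurd ?_ hsn
    obtain ⟨-, e, he⟩ := mem_filter.1 hπ
    simpa using Fintype.card_le_of_injective e he.1.injective

end Shape

/-! ### Assembly over all kernel shapes -/

theorem exists_hasKernelShape {n : ℕ} {π : Equiv.Perm (Fin n)} (hπ : Involutive π) :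
    ∃ ρ : Σ s : ℕ, Equiv.Perm (Fin s), HasKernelShape π ρ.2 := by
  classical
  let K : Finset (Fin n) := {j | j ∈ kernel π}
  let e : Fin #K → Fin n := K.orderEmbOfFin rfl
  have he : StrictMono e := (K.orderEmbOfFin rfl).strictMono
  have hr : Set.range e = kernel π := by
    rw [range_orderEmbOfFin]
    ext j
    simp [K]
  have hex : ∀ k, ∃ k', e k' = π (e k) := fun k => by
    have := (kernel_closed hπ).1 (e k) (by rw [← hr]; exact ⟨k, rfl⟩)
    rwa [← hr] at this
  choose φ hφ using hex
  have hinv : Involutive φ := fun k => he.injective (by rw [hφ, hφ, hπ])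
  refine ⟨⟨#K, hinv.toPerm⟩, e, he, hr, fun a b => ?_⟩
  rw [← hφ, ← hφ, he.lt_iff_lt]
  rfl

theorem HasKernelShape.unique {n : ℕ} {π : Equiv.Perm (Fin n)}
    (hπ : Involutive π) {ρ ρ' : Σ s : ℕ, Equiv.Perm (Fin s)} (h : HasKernelShape π ρ.2)
    (h' : HasKernelShape π ρ'.2) : ρ = ρ' := by
  obtain ⟨s, ρ⟩ := ρ
  obtain ⟨s', ρ'⟩ := ρ'
  obtain ⟨e, he⟩ := h
  obtain ⟨e', he'⟩ := h'
  dsimp only at *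
  have hcard : ∀ {s} {e : Fin s → Fin n}, Injective e → Nat.card (Set.range e) = s := fun {s e} h => by
    rw [Nat.card_range_of_injective h, Nat.card_eq_fintype_card, Fintype.card_fin]
  obtain rfl : s = s' := by
    have h1 := hcard he.1.injective
    have h2 := hcard he'.1.injective
    rw [he.2.1] at h1
    rw [he'.2.1] at h2
    exact h1.symm.trans h2
  obtain rfl := (he.1.range_inj he'.1).1 (he.2.1.trans he'.2.1.symm)
  congr 1
  ext k
  rw [he.1.injective ((he.map hπ k).symm.trans (he'.map hπ k))]

/-- The shape has at most `r` occurrences, hence at most `2 * r + 2` letters, and padding makes it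
the shape of an involution of exactly that size. -/
theorem existsUnique_kernelShape {r n : ℕ} (hn : 0 < n) {π : Equiv.Perm (Fin n)}
    (hπ : π ∈ involutions r n) :
    ∃! ρ : Σ s : ℕ, Equiv.Perm (Fin s), ρ ∈ kernelShapes (2 * r + 2) ∧ HasKernelShape π ρ.2 := by
  obtain ⟨hinv, hr⟩ : Involutive π ∧ occCount p3412 π = r := by
    simpa only [involutions, mem_filter, mem_univ, true_and] using hπ
  obtain ⟨⟨s, ρ⟩, h⟩ := exists_hasKernelShape hinv
  refine ⟨⟨s, ρ⟩, ⟨?_, h⟩, fun ρ' h' => h'.2.unique hinv h⟩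
  have hle := occCount_le_of_hasKernelShape hinv h
  obtain ⟨e, he⟩ := h
  have hρ := he.involutive hinv
  have hL := he.linked hinv
  have hs := he.pos hn
  have := hL.card_le hρ hs
  exact mem_kernelShapes_of_linked hρ hL hs (by dsimp only at *; omega)

theorem coeff_zero_signedGF (r : ℕ) : coeff 0 (signedGF r) = if r = 0 then 1 else 0 := by
  have h : ∀ {m : ℕ} (τ : Equiv.Perm (Fin (m + 1))) (π : Equiv.Perm (Fin 0)), occCount τ π = 0 :=
    fun τ π => card_eq_zero.2 (eq_empty_of_forall_notMem fun i => (i 0).elim0)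
  have h1 : ∀ π : Equiv.Perm (Fin 0), occCount p3412 π = 0 := h p3412
  have h2 : ∀ π : Equiv.Perm (Fin 0), occCount p21 π = 0 := h p21
  rw [coeff_signedGF]
  simp only [involutions, h1, h2, pow_zero, sum_const, nsmul_eq_mul, mul_one]
  split_ifs with hr
  · subst hr
    have : ∀ π : Equiv.Perm (Fin 0), Involutive π := fun _ x => x.elim0
    simp [this, h1]
  · simp [h1, Ne.symm hr]

end Inv3412

theorem theorem4p2 (r : ℕ) :
    Inv3412.signedGF r - (if r = 0 then 1 else 0) =
      ∑ ρ ∈ Inv3412.kernelShapes (2 * r + 2),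
        (-1) ^ Inv3412.occCount Inv3412.p21 ρ.2 * PowerSeries.X ^ ρ.1 *
            (1 + PowerSeries.X) ^ Inv3412.numDiagDec ρ.2 *
            ((1 + PowerSeries.X ^ 2) ^ (Inv3412.numDec ρ.2 + Inv3412.numDiagDec ρ.2))⁻¹ *
          (if Inv3412.occCount Inv3412.p3412 ρ.2 ≤ r then
            ∑ t ∈ Finset.piAntidiag (Finset.univ : Finset (Fin (Inv3412.numFree ρ.2)))
                (r - Inv3412.occCount Inv3412.p3412 ρ.2),
              ∏ j, Inv3412.signedGF (t j)
          else 0) := by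
  classical
  have hK : ∀ ρ ∈ Inv3412.kernelShapes (2 * r + 2),
      Function.Involutive ρ.2 ∧ Inv3412.Linked ρ.2 ∧ 0 < ρ.1 := fun ρ hρ => by
    obtain ⟨π, hπ, e, he⟩ := (Inv3412.mem_kernelShapes ρ).1 hρ
    exact ⟨he.involutive hπ, he.linked hπ, he.pos (Nat.succ_pos _)⟩
  ext n
  rw [map_sub, map_sum, Finset.sum_congr rfl fun ρ hρ =>
    (Inv3412.sum_hasKernelShape (hK ρ hρ).1 (hK ρ hρ).2.1 r n).symm]
  rcases n.eq_zero_or_pos with rfl | hn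
  -- Every shape in the sum has a letter, so the empty involution has none of them and only the
  -- subtracted constant meets it.
  · rw [Inv3412.coeff_zero_signedGF, Finset.sum_eq_zero fun ρ hρ => ?_]
    · split_ifs <;> simp
    · refine Finset.sum_eq_zero fun π hπ => ?_
      obtain ⟨e, -⟩ := (Finset.mem_filter.1 hπ).2
      exact (e ⟨0, (hK ρ hρ).2.2⟩).elim0
  · rw [Inv3412.coeff_signedGF, Inv3412.sum_eq_sum_of_existsUnique
      (S := Inv3412.kernelShapes (2 * r + 2))
      (R := fun π ρ => Inv3412.HasKernelShape π ρ.2)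
      fun π hπ => Inv3412.existsUnique_kernelShape hn hπ]
    have : PowerSeries.coeff n (if r = 0 then 1 else 0 : PowerSeries ℚ) = 0 := by
      split_ifs
      · rw [PowerSeries.coeff_one, if_neg hn.ne']
      · rw [map_zero]
    rw [this, sub_zero]
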